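/- Let $K$ be an algebraically closed field and let $\Lambda$ be an indecomposable finite-dimensional symmetric $K$-algebra with Jacobson radical $J$ such that $J^3=0$ and $J^2\neq 0$. (Symmetric means: there is a linear form $\nu:\Lambda\to K$ with $\nu(ab)=\nu(ba)$ whose kernel contains no nonzero left or right ideal.) Let $S_1,\dots,S_n$ be a complete list of pairwise non-isomorphic simple $\Lambda$-modules. For a diagram $\mathcal D$ with vertices $1,\dots,n$ we say that $\Lambda$ (with this labelling of its simple modules) is of type $\mathcal D$ if $\dim_K\operatorname{Ext}^1_\Lambda(S_i,S_j)$ is the number of edges between $i$ and $j$ in $\mathcal D$ for all $i,j$, a loop at $i$ counting as one edge from $i$ to $i$; that is, the quiver of $\Lambda$ is obtained from $\mathcal D$ by replacing each edge between distinct vertices by a pair of opposite arrows and each loop by one loop. The diagrams are labelled as follows. - $A_n$ ($n\ge 2$): the line $1-2-\cdots-n$. - $L_n$ ($n\ge 2$): the line $1-2-\cdots-n$ with one loop at $1$. - $D_n$ ($n\ge 4$): the line $3-4-\cdots-n$, with $1$ and $2$ both joined to $3$. - $E_6$: the line $1-2-3-5-6$, with $4$ joined to $3$. - $E_7$: the line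 $1-2-\cdots-6$, with $7$ joined to $3$. - $E_8$: the line $1-2-\cdots-7$, with $8$ joined to $3$. For a $\Lambda$-module $M$ let $\Omega(M)$ be the kernel of a projective cover of $M$ (determined up to isomorphism), and let $\Omega^j$ be its $j$-fold iterate. Then, for all $i$ and up to isomorphism: - Type $A_n$: $\Omega^j(S_i)$ is not simple for $0<j<n$, and $\Omega^n(S_i)=S_{n-i+1}$. - Type $L_n$: $\Omega^j(S_i)$ is not simple for $0<j<2n$, and $\Omega^{2n}(S_i)=S_i$. - Type $D_n$: $\Omega^j(S_i)$ is not simple for $0<j<2n-3$, and $\Omega^{2n-3}(S_i)=S_i$, except that for odd $n$ one has $\Omega^{2n-3}(S_1)=S_2$ and $\Omega^{2n-3}(S_2)=S_1$. - Type $E_6$: $\Omega^j(S_i)$ is not simple for $0<j<11$, and $\Omega^{11}(S_i)=S_i$ for $i=3,4$, $\Omega^{11}(S_i)=S_{7-i}$ for $i=1,2,5,6$. - Type $E_7$: $\Omega^j(S_i)$ is not simple for $0<j<17$, and $\Omega^{17}(S_i)=S_i$. - Type $E_8$: $\Omega^j(S_i)$ is not simple for $0<j<29$, and $\Omega^{29}(S_i)=S_i$.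 -/

import Mathlib

universe u v

open CategoryTheory

/-! ### The class of algebras -/

/-- `Λ` is a symmetric `K`-algebra: there is a linear form `ν` with `ν (a b) = ν (b a)` whose kernel
contains no nonzero left ideal and no nonzero right ideal. -/
def IsSymmetricAlg (K : Type v) [Field K] (Λ : Type u) [Ring Λ] [Algebra K Λ] : Prop :=
  ∃ ν : Λ →ₗ[K] K,
    (∀ a b : Λ, ν (a * b) = ν (b * a)) ∧
    (∀ I : Submodule Λ Λ, (∀ x ∈ I, ν x = 0) → I = ⊥) ∧
    (∀ I : Submodule Λᵐᵒᵖ Λ, (∀ x ∈ I, ν x = 0) → I = ⊥)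

/-- `Λ` is indecomposable as an algebra: it is nonzero and not a product of two nonzero algebras,
that is, its only central idempotents are `0` and `1`. -/
def IsIndecomposableAlg (Λ : Type u) [Ring Λ] : Prop :=
  Nontrivial Λ ∧ ∀ e ∈ Subring.center Λ, e * e = e → e = 0 ∨ e = 1

/-- Indecomposable finite-dimensional symmetric algebras with radical cube zero and nonzero
radical square. -/
structure IsSymmetricRadCubeZero (K : Type v) [Field K] (Λ : Type u) [Ring Λ] [Algebra K Λ] :
    Prop where
  finite : Module.Finite K Λ
  symmetric : IsSymmetricAlg K Λ
  indecomposable : IsIndecomposableAlg Λ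
  rad_cube : Ring.jacobson Λ ^ 3 = ⊥
  rad_sq : Ring.jacobson Λ ^ 2 ≠ ⊥

/-- `S 0, …, S (n - 1)` is a complete list, without repetition, of the simple left `Λ`-modules
up to isomorphism. -/
structure IsCompleteSimpleList {Λ : Type u} [Ring Λ] {n : ℕ} (S : Fin n → ModuleCat.{u} Λ) :
    Prop where
  simple : ∀ i, IsSimpleModule Λ (S i)
  injective : ∀ i j, Nonempty (S i ≅ S j) → i = j
  complete : ∀ T : ModuleCat.{u} Λ, IsSimpleModule Λ T → ∃ i, Nonempty (T ≅ S i)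

/-- `Λ`, with its simple modules labelled by `S`, is an algebra whose quiver is the quiver of the
diagram with adjacency matrix `D` (each edge replaced by a pair of opposite arrows, each loop by a
loop): it belongs to the class above, and `dim Ext¹(S i, S j)`, the number of arrows between `i`
and `j` in the quiver of `Λ`, is the entry `D i j`. -/
structure IsOfDiagramType (K : Type v) [Field K] {Λ : Type u} [Ring Λ] [Algebra K Λ] {n : ℕ}
    (D : Matrix (Fin n) (Fin n) ℕ) (S : Fin n → ModuleCat.{u} Λ) : Prop where
  algebra : IsSymmetricRadCubeZero K Λ
  simples : IsCompleteSimpleList S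
  ext_dim : ∀ i j, Module.finrank K (Abelian.Ext (S i) (S j) 1) = D i j

/-! ### The diagrams

The vertex labelled `k` (`1 ≤ k ≤ n`) is the element `k - 1` of `Fin n`. -/

/-- Adjacency matrix of the simple graph whose edges are the pairs `{i, j}` with `E i j` or
`E j i`; in terms of labels `1, …, n`. -/
def edgeMatrix (n : ℕ) (E : ℕ → ℕ → Prop) [DecidableRel E] : Matrix (Fin n) (Fin n) ℕ :=
  fun i j => if E (i.val + 1) (j.val + 1) ∨ E (j.val + 1) (i.val + 1) then 1 else 0

/-- `Aₙ`: the line `1 — 2 — ⋯ — n`. -/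
def diagramA (n : ℕ) : Matrix (Fin n) (Fin n) ℕ :=
  edgeMatrix n fun a b => b = a + 1

/-- `Lₙ`: the line `1 — 2 — ⋯ — n` with one loop at `1`. -/
def diagramL (n : ℕ) : Matrix (Fin n) (Fin n) ℕ :=
  edgeMatrix n fun a b => b = a + 1 ∨ (a = 1 ∧ b = 1)

/-- `Dₙ`: the line `3 — 4 — ⋯ — n`, with `1` and `2` both joined to `3`. -/
def diagramD (n : ℕ) : Matrix (Fin n) (Fin n) ℕ :=
  edgeMatrix n fun a b => (a = 1 ∧ b = 3) ∨ (2 ≤ a ∧ b = a + 1)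

/-- `E₆`: the line `1 — 2 — 3 — 5 — 6`, with `4` joined to `3`. -/
def diagramE6 : Matrix (Fin 6) (Fin 6) ℕ :=
  edgeMatrix 6 fun a b => (a, b) ∈ [(1, 2), (2, 3), (3, 5), (5, 6), (3, 4)]

/-- `E₇`: the line `1 — 2 — ⋯ — 6`, with `7` joined to `3`. -/
def diagramE7 : Matrix (Fin 7) (Fin 7) ℕ :=
  edgeMatrix 7 fun a b => (a, b) ∈ [(1, 2), (2, 3), (3, 4), (4, 5), (5, 6), (3, 7)]

/-- `E₈`: the line `1 — 2 — ⋯ — 7`, with `8` joined to `3`. -/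
def diagramE8 : Matrix (Fin 8) (Fin 8) ℕ :=
  edgeMatrix 8 fun a b => (a, b) ∈ [(1, 2), (2, 3), (3, 4), (4, 5), (5, 6), (6, 7), (3, 8)]

/-! ### Syzygies -/

/-- `f : P → M` is a projective cover: `P` is projective and `f` is surjective with superfluous
kernel. -/
structure IsProjectiveCover {Λ : Type u} [Ring Λ] {P M : ModuleCat.{u} Λ} (f : P →ₗ[Λ] M) :
    Prop where
  projective : Module.Projective Λ P
  surjective : Function.Surjective f
  superfluous : ∀ N : Submodule Λ P, N ⊔ LinearMap.ker f = ⊤ → N = ⊤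

/-- `N` is (isomorphic to) `Ω M`, the kernel of a projective cover of `M`. -/
def IsSyzygy {Λ : Type u} [Ring Λ] (M N : ModuleCat.{u} Λ) : Prop :=
  ∃ (P : ModuleCat.{u} Λ) (f : P →ₗ[Λ] M),
    IsProjectiveCover f ∧ Nonempty (N ≃ₗ[Λ] LinearMap.ker f)

/-- `N` is (isomorphic to) `Ωʲ M`. -/
def IsNthSyzygy {Λ : Type u} [Ring Λ] : ℕ → ModuleCat.{u} Λ → ModuleCat.{u} Λ → Prop
  | 0, M, N => Nonempty (M ≅ N)
  | j + 1, M, N => ∃ L : ModuleCat.{u} Λ, IsNthSyzygy j M L ∧ IsSyzygy L N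

/-- For all `i`, `Ωʲ (S i)` is not simple for `0 < j < m`, while `Ωᵐ (S i)` exists and is
`S (σ i)` up to isomorphism. -/
def FirstSimpleSyzygy {Λ : Type u} [Ring Λ] {n : ℕ} (S : Fin n → ModuleCat.{u} Λ)
    (m : ℕ) (σ : Fin n → Fin n) : Prop :=
  ∀ i : Fin n,
    (∀ j : ℕ, 0 < j → j < m → ∀ N : ModuleCat.{u} Λ,
      IsNthSyzygy j (S i) N → ¬ IsSimpleModule Λ N) ∧
    (∀ N : ModuleCat.{u} Λ, IsNthSyzygy m (S i) N ↔ Nonempty (N ≅ S (σ i)))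

/-! Let `M` be an indecomposable module with `J M` semisimple, let `t` and `s` be the multiplicity
vectors of the simple modules in `M / J M` and in `J M`, and let `N` be the kernel of a projective
cover `P → M`. Then `J² P = soc P ⊆ N ⊆ J P`. The socle of `P` has the same multiplicities `t` as
its top, because the algebra is symmetric. The layer `J P / J² P` has multiplicities `t D`, which is
how `Ext¹` enters. As `J P` maps onto `J M`, the quotient `N / J² P` has multiplicities `q = t D -
s`. Moreover `N` is again indecomposable, since projectives are injective. If `q ≠ 0`, then `N` is
not semisimple and `rad N = soc N = J² P`, so the pair `(t, s)` becomes `(t D - s, t)`. If `q = 0`,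
then `N = soc P` is semisimple and indecomposable, hence simple.

Starting from `(eᵢ, 0)` for `S i`, the tops of the syzygies therefore solve the discrete wave
equation `u (k + 2) + u k = u (k + 1) D` on the diagram, and the first simple syzygy occurs at the
time `m` for which `u (m + 1)` first vanishes; it is read off from `u m`.

The module theory rests on `IsSymmetrizing.finrank_hom_projective` (socle against top),
`IsOfDiagramType.radSocle_projective` (socle is `J² P`) and
`IsSymmetrizing.endNilpotentOrBijective_ker` (indecomposability), which are combined in
`IsOfDiagramType.layers_ker`. The wave equation is solved in closed form on a line. Types `L` and
`D` are folded from longer lines, and the three exceptional diagrams are finite computations. -/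

/-! ### Symmetrizing forms -/

/-- A symmetrizing form on the `K`-algebra `Λ`. -/
structure IsSymmetrizing {K : Type v} [Field K] {Λ : Type u} [Ring Λ] [Algebra K Λ]
    (ν : Λ →ₗ[K] K) : Prop where
  symm : ∀ a b, ν (a * b) = ν (b * a)
  nondeg : ∀ x, (∀ a, ν (a * x) = 0) → x = 0

theorem IsSymmetricAlg.exists_isSymmetrizing {K : Type v} [Field K] {Λ : Type u} [Ring Λ]
    [Algebra K Λ] (h : IsSymmetricAlg K Λ) : ∃ ν : Λ →ₗ[K] K, IsSymmetrizing ν := by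
  obtain ⟨ν, hs, hl, -⟩ := h
  refine ⟨ν, hs, fun x hx => ?_⟩
  have := hl (Submodule.span Λ {x}) fun y hy => by
    obtain ⟨a, rfl⟩ := Submodule.mem_span_singleton.1 hy
    exact hx a
  simpa using this

theorem finrank_le_of_separating {K V W : Type*} [Field K] [AddCommGroup V] [Module K V]
    [AddCommGroup W] [Module K W] [FiniteDimensional K W] (B : V →ₗ[K] W →ₗ[K] K)
    (hB : ∀ v, (∀ w, B v w = 0) → v = 0) : Module.finrank K V ≤ Module.finrank K W := by
  rw [← Subspace.dual_finrank_eq (K := K) (V := W)]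
  refine LinearMap.finrank_le_finrank_of_injective (f := B) ?_
  rw [injective_iff_map_eq_zero]
  intro v hv
  exact hB v fun w => by rw [hv]; rfl

section Form

variable {K : Type v} [Field K] {Λ : Type u} [Ring Λ] [Algebra K Λ]

theorem finite_hom_of_finite (X Y : Type*) [AddCommGroup X] [Module Λ X] [Module K X]
    [IsScalarTower K Λ X] [AddCommGroup Y] [Module Λ Y] [Module K Y] [IsScalarTower K Λ Y]
    [Module.Finite K X] [Module.Finite K Y] : Module.Finite K (X →ₗ[Λ] Y) :=
  .of_injective (LinearMap.restrictScalarsₗ K Λ X Y K) (LinearMap.restrictScalars_injective _)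

theorem finite_of_finite_of_finite [Module.Finite K Λ] (X : Type*) [AddCommGroup X] [Module Λ X]
    [Module K X] [IsScalarTower K Λ X] [Module.Finite Λ X] : Module.Finite K X :=
  Module.Finite.trans Λ X

variable {ν : Λ →ₗ[K] K}

theorem IsSymmetrizing.ext_hom (hν : IsSymmetrizing ν) {X : Type*} [AddCommGroup X] [Module Λ X]
    {k k' : X →ₗ[Λ] Λ} (h : ∀ x, ν (k x) = ν (k' x)) : k = k' := by
  ext x
  refine sub_eq_zero.1 (hν.nondeg _ fun a => ?_)
  have := h (a • x)
  simp only [map_smul, smul_eq_mul] at this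
  rw [mul_sub, map_sub, this, sub_self]

theorem IsSymmetrizing.exists_mul_eq [Module.Finite K Λ] (hν : IsSymmetrizing ν)
    (l : Λ →ₗ[K] K) : ∃ b, ∀ a, ν (a * b) = l a := by
  let B : Λ →ₗ[K] Module.Dual K Λ := LinearMap.mk₂ K (fun b a => ν (a * b))
    (by simp [mul_add]) (by simp) (by simp [add_mul]) (by simp)
  have hB : Function.Injective B := by
    rw [injective_iff_map_eq_zero]
    intro x hx
    exact hν.nondeg x fun a => LinearMap.congr_fun hx a
  obtain ⟨b, hb⟩ := (LinearMap.injective_iff_surjective_of_finrank_eq_finrank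
    (Subspace.dual_finrank_eq (K := K) (V := Λ)).symm).1 hB l
  exact ⟨b, fun a => LinearMap.congr_fun hb a⟩

/-- Composition with `ν` identifies `Hom_Λ(X, Λ)` with the `K`-dual of `X`: the value `k x` is the
element representing the form `a ↦ l (a x)`, and its uniqueness makes `k` linear over `Λ`. -/
theorem IsSymmetrizing.exists_hom [Module.Finite K Λ] (hν : IsSymmetrizing ν) {X : Type*}
    [AddCommGroup X] [Module Λ X] [Module K X] [IsScalarTower K Λ X] (l : X →ₗ[K] K) :
    ∃ k : X →ₗ[Λ] Λ, ∀ x, ν (k x) = l x := by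
  have h (x : X) : ∃ b, ∀ a, ν (a * b) = l (a • x) :=
    hν.exists_mul_eq (l ∘ₗ (LinearMap.toSpanSingleton Λ X x).restrictScalars K)
  choose k hk using h
  have huniq {x y : Λ} (h : ∀ a, ν (a * x) = ν (a * y)) : x = y :=
    sub_eq_zero.1 (hν.nondeg _ fun a => by rw [mul_sub, map_sub, h, sub_self])
  refine ⟨⟨⟨k, fun x y => huniq fun a => ?_⟩, fun b x => huniq fun a => ?_⟩, fun x => ?_⟩
  · rw [hk, mul_add, map_add, hk, hk, smul_add, map_add]
  · rw [hk, smul_smul, ← hk, RingHom.id_apply, smul_eq_mul, mul_assoc]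
  · simpa using hk x 1

theorem exists_retract_of_projective (P : Type*) [AddCommGroup P] [Module Λ P]
    [Module.Finite Λ P] [Module.Projective Λ P] :
    ∃ (n : ℕ) (i : P →ₗ[Λ] (Fin n → Λ)) (p : (Fin n → Λ) →ₗ[Λ] P), ∀ x, p (i x) = x := by
  obtain ⟨n, p, hp⟩ := Module.Finite.exists_fin' Λ P
  obtain ⟨i, hi⟩ := Module.projective_lifting_property p LinearMap.id hp
  exact ⟨n, i, p, fun x => LinearMap.congr_fun hi x⟩

/-- Finite projectives are injective: in coordinates of a free module containing `P` as a summand,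
maps to `Λ` are the same as `K`-linear forms, and these extend along a `K`-linear retraction of `j`.
-/
theorem IsSymmetrizing.exists_extend [Module.Finite K Λ] (hν : IsSymmetrizing ν) {X N P : Type*}
    [AddCommGroup X] [Module Λ X] [Module K X] [IsScalarTower K Λ X]
    [AddCommGroup N] [Module Λ N] [Module K N] [IsScalarTower K Λ N]
    [AddCommGroup P] [Module Λ P] [Module.Finite Λ P] [Module.Projective Λ P]
    (j : N →ₗ[Λ] X) (hj : Function.Injective j) (g : N →ₗ[Λ] P) :
    ∃ g' : X →ₗ[Λ] P, ∀ x, g' (j x) = g x := by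
  obtain ⟨n, i, p, hip⟩ := exists_retract_of_projective (Λ := Λ) P
  obtain ⟨r, hr⟩ := (j.restrictScalars K).exists_leftInverse_of_injective
    (LinearMap.ker_eq_bot.2 hj)
  have h (a : Fin n) : ∃ k : X →ₗ[Λ] Λ, ∀ x, k (j x) = i (g x) a := by
    obtain ⟨k, hk⟩ := hν.exists_hom
      (ν ∘ₗ (LinearMap.proj a ∘ₗ i ∘ₗ g : N →ₗ[Λ] Λ).restrictScalars K ∘ₗ r)
    have := hν.ext_hom (k := k ∘ₗ j) (k' := LinearMap.proj a ∘ₗ i ∘ₗ g) fun x => by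
      have hx : r (j x) = x := LinearMap.congr_fun hr x
      simp [hk, hx]
    exact ⟨k, fun x => LinearMap.congr_fun this x⟩
  choose k hk using h
  refine ⟨p ∘ₗ LinearMap.pi k, fun x => ?_⟩
  rw [LinearMap.comp_apply, ← hip (g x)]
  congr 1
  ext a
  exact hk a x

/-- The composite of the form `ν` with the matrix trace on endomorphisms of `Λⁿ`. -/
def formTrace (ν : Λ →ₗ[K] K) {n : ℕ} (U : (Fin n → Λ) →ₗ[Λ] (Fin n → Λ)) : K :=
  ∑ a, ν (U (Pi.single a 1) a)

theorem IsSymmetrizing.formTrace_comp (hν : IsSymmetrizing ν) {n : ℕ}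
    (U V : (Fin n → Λ) →ₗ[Λ] (Fin n → Λ)) :
    formTrace ν (U ∘ₗ V) = formTrace ν (V ∘ₗ U) := by
  have key (U V : (Fin n → Λ) →ₗ[Λ] (Fin n → Λ)) : formTrace ν (U ∘ₗ V) =
      ∑ a, ∑ b, ν (V (Pi.single a 1) b * U (Pi.single b 1) a) := by
    refine Finset.sum_congr rfl fun a _ => ?_
    have : V (Pi.single a 1) = ∑ b, V (Pi.single a 1) b • (Pi.single b 1 : Fin n → Λ) := by
      ext c
      simp [Finset.sum_apply, Pi.single_apply]
    rw [LinearMap.comp_apply, this, map_sum, Finset.sum_apply, map_sum]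
    simp [Finset.sum_apply, Pi.single_apply]
  rw [key, key, Finset.sum_comm]
  simp_rw [hν.symm]

/-- The pairing sending `(g, f)` to the `ν`-trace of `g f`, computed on a free module retracting
onto `P`, separates points on both sides. For simple `T` this says that socle and top of `P` have
the same multiplicities. -/
theorem IsSymmetrizing.finrank_hom_projective [Module.Finite K Λ] (hν : IsSymmetrizing ν)
    (P T : Type*) [AddCommGroup P] [Module Λ P] [Module K P] [IsScalarTower K Λ P]
    [Module.Finite Λ P] [Module.Projective Λ P] [AddCommGroup T] [Module Λ T] [Module K T]
    [IsScalarTower K Λ T] [Module.Finite K T] :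
    Module.finrank K (T →ₗ[Λ] P) = Module.finrank K (P →ₗ[Λ] T) := by
  have := finite_of_finite_of_finite (K := K) (Λ := Λ) P
  have := finite_hom_of_finite (K := K) (Λ := Λ) P T
  have := finite_hom_of_finite (K := K) (Λ := Λ) T P
  obtain ⟨n, i, p, hip⟩ := exists_retract_of_projective (Λ := Λ) P
  have hadd (U V : (Fin n → Λ) →ₗ[Λ] (Fin n → Λ)) :
      formTrace ν (U + V) = formTrace ν U + formTrace ν V := by
    simp [formTrace, Finset.sum_add_distrib]
  have hsmul (c : K) (U : (Fin n → Λ) →ₗ[Λ] (Fin n → Λ)) :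
      formTrace ν (c • U) = c • formTrace ν U := by
    simp [formTrace, Finset.mul_sum]
  let B : (T →ₗ[Λ] P) →ₗ[K] (P →ₗ[Λ] T) →ₗ[K] K := LinearMap.mk₂ K
    (fun g f => formTrace ν ((i ∘ₗ g) ∘ₗ (f ∘ₗ p)))
    (fun g g' f => by rw [LinearMap.comp_add, LinearMap.add_comp, hadd])
    (fun c g f => by
      rw [← hsmul]; congr 1; ext x
      simp)
    (fun g f f' => by rw [LinearMap.add_comp, LinearMap.comp_add, hadd])
    (fun c g f => by
      rw [← hsmul]; congr 1; ext x
      simp)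
  -- Symmetry of the trace absorbs the idempotent `i ∘ p`, so test maps may be chosen freely on the
  -- free module.
  have htr (g : T →ₗ[Λ] P) (f : (Fin n → Λ) →ₗ[Λ] T) :
      B g (f ∘ₗ i) = formTrace ν ((i ∘ₗ g) ∘ₗ f) := by
    have h1 : B g (f ∘ₗ i) = formTrace ν (((i ∘ₗ g) ∘ₗ f) ∘ₗ (i ∘ₗ p)) := rfl
    rw [h1, hν.formTrace_comp]
    congr 1
    ext x
    simp [hip]
  have htr' (g : T →ₗ[Λ] (Fin n → Λ)) (f : P →ₗ[Λ] T) :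
      B (p ∘ₗ g) f = formTrace ν (g ∘ₗ (f ∘ₗ p)) := by
    have h1 : B (p ∘ₗ g) f = formTrace ν ((i ∘ₗ p) ∘ₗ (g ∘ₗ (f ∘ₗ p))) := rfl
    rw [h1, hν.formTrace_comp]
    congr 1
    ext x
    simp [hip]
  refine le_antisymm (finrank_le_of_separating B fun g hg => ?_)
    (finrank_le_of_separating B.flip fun f hf => ?_)
  · ext s
    rw [← hip (g s)]
    suffices i (g s) = 0 by simp [this]
    ext a
    refine hν.nondeg _ fun c => ?_
    have h := hg (((LinearMap.toSpanSingleton Λ T (c • s)) ∘ₗ LinearMap.proj a) ∘ₗ i)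
    rw [htr, formTrace, Finset.sum_eq_single a] at h
    · simpa using h
    · intro b _ hb
      simp [hb.symm]
    · simp
  · have hz (a : Fin n) : f (p (Pi.single a 1)) = 0 := by
      by_contra hne
      obtain ⟨l, hl⟩ : ∃ l : T →ₗ[K] K, l (f (p (Pi.single a 1))) ≠ 0 := by
        by_contra! h
        exact hne ((Module.forall_dual_apply_eq_zero_iff K _).1 h)
      obtain ⟨k, hk⟩ := hν.exists_hom l
      have h := hf (p ∘ₗ (LinearMap.single Λ (fun _ => Λ) a ∘ₗ k))
      rw [LinearMap.flip_apply, htr', formTrace, Finset.sum_eq_single a] at h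
      · exact hl (by simpa [hk] using h)
      · intro b _ hb
        simp [hb]
      · simp
    have : f ∘ₗ p = 0 := by
      refine LinearMap.pi_ext' fun a => LinearMap.ext_ring ?_
      simpa using hz a
    ext x
    rw [← hip x]
    exact LinearMap.congr_fun this (i x)

end Form

/-! ### Dimensions of spaces of homomorphisms -/

section HomDim

/-- The dimension of `Hom_Λ(X, T)`. -/
noncomputable def homDim (K : Type v) [Field K] (Λ : Type u) [Ring Λ] [Algebra K Λ]
    (X T : Type*) [AddCommGroup X] [Module Λ X] [AddCommGroup T] [Module Λ T]
    [Module K T] [IsScalarTower K Λ T] : ℕ :=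
  Module.finrank K (X →ₗ[Λ] T)

variable {K : Type v} [Field K] {Λ : Type u} [Ring Λ] [Algebra K Λ]
  {X Y T : Type*} [AddCommGroup X] [Module Λ X] [AddCommGroup Y] [Module Λ Y]
  [AddCommGroup T] [Module Λ T] 

theorem homDim_congr_left [Module K T] [IsScalarTower K Λ T] (e : X ≃ₗ[Λ] Y) :
    homDim K Λ X T = homDim K Λ Y T :=
  (LinearEquiv.congrLeft T K e).finrank_eq

theorem homDim_congr_right [Module K X] [IsScalarTower K Λ X] [Module K Y] [IsScalarTower K Λ Y]
    (e : X ≃ₗ[Λ] Y) : homDim K Λ T X = homDim K Λ T Y := by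
  refine LinearEquiv.finrank_eq (LinearEquiv.ofLinearMap (LinearMap.compRight K e.toLinearMap)
    (LinearMap.compRight K e.symm.toLinearMap) ?_ ?_) <;> ext <;> simp

theorem homDim_quotient [Module K T] [IsScalarTower K Λ T] (N : Submodule Λ X)
    (hN : ∀ f : X →ₗ[Λ] T, N ≤ LinearMap.ker f) : homDim K Λ (X ⧸ N) T = homDim K Λ X T := by
  refine LinearEquiv.finrank_eq (LinearEquiv.ofBijective (LinearMap.lcomp K T N.mkQ)
    ⟨fun f g h => ?_, fun f => ⟨N.liftQ f (hN f), ?_⟩⟩)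
  · ext x
    exact LinearMap.congr_fun h x
  · ext x
    simp

theorem homDim_submodule [Module K X] [IsScalarTower K Λ X] (N : Submodule Λ X)
    (hN : ∀ f : T →ₗ[Λ] X, LinearMap.range f ≤ N) : homDim K Λ T N = homDim K Λ T X := by
  refine LinearEquiv.finrank_eq (LinearEquiv.ofBijective (LinearMap.compRight K N.subtype)
    ⟨fun f g h => ?_, fun f => ⟨f.codRestrict N fun x => hN f ⟨x, rfl⟩, ?_⟩⟩)
  · ext x
    exact LinearMap.congr_fun h x
  · ext x
    simp

theorem homDim_prod [Module K X] [IsScalarTower K Λ X] [Module.Finite K X]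
    [Module K Y] [IsScalarTower K Λ Y] [Module.Finite K Y]
    [Module K T] [IsScalarTower K Λ T] [Module.Finite K T] :
    homDim K Λ (X × Y) T = homDim K Λ X T + homDim K Λ Y T := by
  have := finite_hom_of_finite (K := K) (Λ := Λ) X T
  have := finite_hom_of_finite (K := K) (Λ := Λ) Y T
  rw [homDim, ← (LinearMap.coprodEquiv K (M := X) (M₂ := Y) (M₃ := T) (R := Λ)).finrank_eq,
    Module.finrank_prod]
  rfl

theorem homDim_eq_add_of_isCompl [Module K X] [IsScalarTower K Λ X] [Module.Finite K X]
    [Module K T] [IsScalarTower K Λ T] [Module.Finite K T] {N N' : Submodule Λ X}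
    (h : IsCompl N N') : homDim K Λ X T = homDim K Λ N T + homDim K Λ N' T := by
  have (N : Submodule Λ X) : Module.Finite K N := inferInstanceAs (Module.Finite K (N.restrictScalars K))
  rw [← homDim_congr_left (Submodule.prodEquivOfIsCompl N N' h), homDim_prod]

theorem homDim_eq_add_quotient [IsSemisimpleModule Λ X]
    [Module K X] [IsScalarTower K Λ X] [Module.Finite K X]
    [Module K T] [IsScalarTower K Λ T] [Module.Finite K T] (N : Submodule Λ X) :
    homDim K Λ X T = homDim K Λ N T + homDim K Λ (X ⧸ N) T := by
  obtain ⟨N', h⟩ := exists_isCompl N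
  rw [homDim_eq_add_of_isCompl h, homDim_congr_left (Submodule.quotientEquivOfIsCompl N N' h)]

/-- A nonzero map between `X` and a simple module splits, so composing to `End T` and applying a
form that is nonzero on the identity is a nondegenerate pairing. -/
theorem homDim_comm [IsSemisimpleModule Λ X] [IsSimpleModule Λ T]
    [Module K X] [IsScalarTower K Λ X] [Module.Finite K X]
    [Module K T] [IsScalarTower K Λ T] [Module.Finite K T] :
    homDim K Λ X T = homDim K Λ T X := by
  have := finite_hom_of_finite (K := K) (Λ := Λ) X T
  have := finite_hom_of_finite (K := K) (Λ := Λ) T X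
  have := IsSimpleModule.nontrivial Λ T
  obtain ⟨r, hr⟩ : ∃ r : (T →ₗ[Λ] T) →ₗ[K] K, r LinearMap.id ≠ 0 := by
    by_contra! h
    exact one_ne_zero (α := Module.End Λ T) ((Module.forall_dual_apply_eq_zero_iff K _).1 h)
  let B : (X →ₗ[Λ] T) →ₗ[K] (T →ₗ[Λ] X) →ₗ[K] K := LinearMap.mk₂ K (fun f g => r (f ∘ₗ g))
    (fun f f' g => by rw [LinearMap.add_comp, map_add])
    (fun c f g => by rw [← map_smul]; rfl)
    (fun f g g' => by rw [LinearMap.comp_add, map_add])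
    (fun c f g => by rw [← map_smul]; congr 1; ext; simp)
  refine le_antisymm (finrank_le_of_separating B fun f hf => ?_)
    (finrank_le_of_separating B.flip fun g hg => ?_)
  · by_contra hne
    obtain ⟨g, hg⟩ := IsSemisimpleModule.lifting_property f
      (LinearMap.surjective_of_ne_zero hne) LinearMap.id
    exact hr (by rw [← hg]; exact hf g)
  · by_contra hne
    obtain ⟨f, hf⟩ := IsSemisimpleModule.extension_property g
      (LinearMap.injective_of_ne_zero hne) LinearMap.id
    exact hr (by rw [← hf]; exact hg f)

theorem homDim_self_of_isSimpleModule [IsAlgClosed K] [IsSimpleModule Λ T]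
    [Module K T] [IsScalarTower K Λ T] [Module.Finite K T] : homDim K Λ T T = 1 := by
  rw [homDim, ← (LinearEquiv.ofBijective (Algebra.linearMap K (Module.End Λ T))
    (IsSimpleModule.algebraMap_end_bijective_of_isAlgClosed K)).finrank_eq, Module.finrank_self]

theorem homDim_eq_zero_of_isEmpty [IsSimpleModule Λ X] [IsSimpleModule Λ T]
    [Module K T] [IsScalarTower K Λ T] (h : IsEmpty (X ≃ₗ[Λ] T)) : homDim K Λ X T = 0 := by
  have : Subsingleton (X →ₗ[Λ] T) := by
    refine subsingleton_of_forall_eq 0 fun f => ?_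
    by_contra hf
    exact h.false (LinearEquiv.ofBijective f (LinearMap.bijective_of_ne_zero hf))
  exact Module.finrank_zero_of_subsingleton

end HomDim

/-! ### The radical and the socle of a module -/

section Radical

variable {Λ : Type u} [Ring Λ] {X Y : Type*} [AddCommGroup X] [Module Λ X] [AddCommGroup Y]
  [Module Λ Y]

variable (Λ X) in
/-- The submodule of elements annihilated by the Jacobson radical. -/
def radSocle : Submodule Λ X where
  carrier := {x | ∀ a ∈ Ring.jacobson Λ, a • x = 0}
  add_mem' hx hy a ha := by rw [smul_add, hx a ha, hy a ha, add_zero]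
  zero_mem' a _ := smul_zero a
  smul_mem' b x hx a ha := by rw [smul_smul]; exact hx _ (Ideal.mul_mem_right b _ ha)

theorem map_mem_radSocle (f : X →ₗ[Λ] Y) {x : X} (hx : x ∈ radSocle Λ X) :
    f x ∈ radSocle Λ Y := fun a ha => by rw [← map_smul, hx a ha, map_zero]

theorem map_smul_top_le (I : Ideal Λ) (f : X →ₗ[Λ] Y) :
    (I • (⊤ : Submodule Λ X)).map f ≤ I • ⊤ := by
  rw [Submodule.map_smul'']
  exact Submodule.smul_mono le_rfl le_top

theorem map_smul_top_of_surjective (I : Ideal Λ) (f : X →ₗ[Λ] Y) (hf : Function.Surjective f) :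
    (I • (⊤ : Submodule Λ X)).map f = I • ⊤ := by
  rw [Submodule.map_smul'', Submodule.map_top, LinearMap.range_eq_top.2 hf]

theorem radSocle_eq_top_of_isSemisimpleModule [IsSemisimpleModule Λ X] : radSocle Λ X = ⊤ :=
  eq_top_iff.2 fun x _ _ ha =>
    Module.mem_annihilator.1 (IsSemisimpleModule.jacobson_le_annihilator Λ X ha) x

theorem jacobson_smul_top_le_ker [IsSemisimpleModule Λ Y] (f : X →ₗ[Λ] Y) :
    Ring.jacobson Λ • (⊤ : Submodule Λ X) ≤ LinearMap.ker f :=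
  (Ring.jacobson_smul_top_le Λ X).trans fun _ hx => IsSemisimpleModule.jacobson_le_ker _ _ _ _ f hx

theorem range_le_radSocle [IsSemisimpleModule Λ X] (f : X →ₗ[Λ] Y) :
    LinearMap.range f ≤ radSocle Λ Y := by
  rintro _ ⟨x, rfl⟩
  exact map_mem_radSocle f (radSocle_eq_top_of_isSemisimpleModule (Λ := Λ) (X := X) ▸ trivial)

theorem isSemisimpleModule_of_jacobson_smul_eq_zero [IsArtinianRing Λ]
    (h : ∀ a ∈ Ring.jacobson Λ, ∀ x : X, a • x = 0) : IsSemisimpleModule Λ X := by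
  have hX : Module.IsTorsionBySet Λ X (Ring.jacobson Λ : Set Λ) := fun x a => h a a.2 x
  let := hX.module
  exact hX.isSemisimpleModule_iff.1 inferInstance

instance isSemisimpleModule_radSocle [IsArtinianRing Λ] : IsSemisimpleModule Λ (radSocle Λ X) :=
  isSemisimpleModule_of_jacobson_smul_eq_zero fun a ha x => Subtype.ext (x.2 a ha)

theorem isSemisimpleModule_of_le_radSocle [IsArtinianRing Λ] {N : Submodule Λ X}
    (h : N ≤ radSocle Λ X) : IsSemisimpleModule Λ N :=
  isSemisimpleModule_of_jacobson_smul_eq_zero fun a ha x => Subtype.ext (h x.2 a ha)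

theorem isSemisimpleModule_quotient [IsArtinianRing Λ] {N : Submodule Λ X}
    (h : Ring.jacobson Λ • (⊤ : Submodule Λ X) ≤ N) : IsSemisimpleModule Λ (X ⧸ N) := by
  refine isSemisimpleModule_of_jacobson_smul_eq_zero fun a ha x => ?_
  obtain ⟨x, rfl⟩ := N.mkQ_surjective x
  rw [← map_smul, Submodule.mkQ_apply, Submodule.Quotient.mk_eq_zero]
  exact h (Submodule.smul_mem_smul ha trivial)

theorem jacobson_eq_jacobson_smul_top [IsArtinianRing Λ] :
    Module.jacobson Λ X = Ring.jacobson Λ • (⊤ : Submodule Λ X) := by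
  refine le_antisymm (Module.jacobson_le_of_eq_bot ?_) (Ring.jacobson_smul_top_le Λ X)
  have := isSemisimpleModule_quotient (Λ := Λ) (X := X) le_rfl
  exact IsSemisimpleModule.jacobson_eq_bot _ _

theorem eq_top_of_sup_jacobson_smul_top_eq_top [Module.Finite Λ X] {N : Submodule Λ X}
    (h : N ⊔ Ring.jacobson Λ • (⊤ : Submodule Λ X) = ⊤) : N = ⊤ := by
  have : (⊤ : Submodule Λ (X ⧸ N)) = ⊥ := by
    refine Submodule.FG.eq_bot_of_le_jacobson_smul Module.Finite.fg_top ?_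
    rw [← map_smul_top_of_surjective _ N.mkQ N.mkQ_surjective, ← Submodule.range_mkQ N,
      ← Submodule.map_top]
    conv_lhs => rw [← h]
    rw [Submodule.map_sup, Submodule.mkQ_map_self, bot_sup_eq]
  rw [← Submodule.ker_mkQ N, eq_top_iff]
  intro x _
  rw [LinearMap.mem_ker, ← Submodule.mem_bot Λ, ← this]
  trivial

theorem eq_top_of_sup_eq_top_of_le [Module.Finite Λ X] {N L : Submodule Λ X}
    (hL : L ≤ Ring.jacobson Λ • (⊤ : Submodule Λ X)) (h : N ⊔ L = ⊤) : N = ⊤ :=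
  eq_top_of_sup_jacobson_smul_top_eq_top (eq_top_iff.2 (h ▸ sup_le_sup_left hL N))

theorem le_jacobson_smul_top_of_superfluous [IsArtinianRing Λ] {L : Submodule Λ X}
    (hL : ∀ N : Submodule Λ X, N ⊔ L = ⊤ → N = ⊤) : L ≤ Ring.jacobson Λ • ⊤ := by
  rw [← jacobson_eq_jacobson_smul_top]
  refine le_sInf fun N hN => ?_
  by_contra hle
  refine hN.1 (hL N ?_)
  exact hN.2 _ (left_lt_sup.2 hle)

end Radical

/-! ### Modules whose endomorphisms are nilpotent or bijective -/

section EndNilpotentOrBijective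

variable (Λ : Type u) [Ring Λ] (X : Type*) [AddCommGroup X] [Module Λ X]

/-- Every endomorphism of `X` is nilpotent or bijective. For modules of finite length this says
that `X` is zero or indecomposable. -/
def EndNilpotentOrBijective : Prop :=
  ∀ f : Module.End Λ X, IsNilpotent f ∨ Function.Bijective f

variable {Λ X}

theorem EndNilpotentOrBijective.of_isSimpleModule [IsSimpleModule Λ X] :
    EndNilpotentOrBijective Λ X := fun f =>
  (LinearMap.bijective_or_eq_zero f).symm.imp (fun h => by rw [h]; exact IsNilpotent.zero) id

theorem EndNilpotentOrBijective.congr {Y : Type*} [AddCommGroup Y] [Module Λ Y]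
    (h : EndNilpotentOrBijective Λ X) (e : X ≃ₗ[Λ] Y) : EndNilpotentOrBijective Λ Y := by
  intro f
  refine (h (e.conjRingEquiv.symm f)).imp (fun h => ?_) fun h => ?_
  · simpa using h.map e.conjRingEquiv
  · rw [← Module.End.isUnit_iff] at h ⊢
    simpa using h.map e.conjRingEquiv

/-- Otherwise a nonzero part of the top lifts into the socle and splits off: this yields an
endomorphism `e` with image in the socle and `p e = p` for a nonzero `p`. It is not nilpotent, and
if bijective it makes `X` semisimple. -/
theorem EndNilpotentOrBijective.radSocle_le [IsArtinianRing Λ]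
    (h : EndNilpotentOrBijective Λ X) (hX : ¬ IsSemisimpleModule Λ X) :
    radSocle Λ X ≤ Ring.jacobson Λ • ⊤ := by
  by_contra hle
  set R := Ring.jacobson Λ • (⊤ : Submodule Λ X) with hR
  have hss : IsSemisimpleModule Λ (X ⧸ R) := isSemisimpleModule_quotient le_rfl
  let f : radSocle Λ X →ₗ[Λ] X ⧸ R := R.mkQ ∘ₗ (radSocle Λ X).subtype
  obtain ⟨r, hr⟩ := IsSemisimpleModule.extension_property (LinearMap.range f).subtype
    (Submodule.injective_subtype _) LinearMap.id
  obtain ⟨s, hs⟩ := IsSemisimpleModule.lifting_property f.rangeRestrict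
    f.surjective_rangeRestrict LinearMap.id
  let p : X →ₗ[Λ] LinearMap.range f := r ∘ₗ R.mkQ
  let e : Module.End Λ X := (radSocle Λ X).subtype ∘ₗ s ∘ₗ p
  have hpe : p ∘ₗ e = p := by
    ext x
    have h1 : f (s (p x)) = (p x : X ⧸ R) :=
      congrArg Subtype.val (LinearMap.congr_fun hs (p x))
    have h2 : r (p x : X ⧸ R) = p x := LinearMap.congr_fun hr (p x)
    change (r (f (s (p x))) : X ⧸ R) = p x
    rw [h1, h2]
  rcases h e with hn | hb
  · obtain ⟨k, hk⟩ := hn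
    have hpk : ∀ k, p ∘ₗ (e ^ k) = p := by
      intro k
      induction k with
      | zero => rfl
      | succ k ih => rw [pow_succ, Module.End.mul_eq_comp, ← LinearMap.comp_assoc, ih, hpe]
    have hp : p = 0 := by rw [← hpk k, hk, LinearMap.comp_zero]
    refine hle fun x hx => ?_
    have h1 : r (f ⟨x, hx⟩) = f.rangeRestrict ⟨x, hx⟩ :=
      LinearMap.congr_fun hr (f.rangeRestrict ⟨x, hx⟩)
    have h2 : f.rangeRestrict ⟨x, hx⟩ = 0 := by
      rw [← h1]
      exact LinearMap.congr_fun hp x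
    have h3 : f ⟨x, hx⟩ = 0 := congrArg Subtype.val h2
    exact (Submodule.Quotient.mk_eq_zero R).1 h3
  · refine hX (isSemisimpleModule_of_jacobson_smul_eq_zero fun a ha x => ?_)
    obtain ⟨y, rfl⟩ := hb.2 x
    exact (s (p y)).2 a ha

/-- The projection onto a simple summand fixes a nonzero vector, so it is not nilpotent and must be
bijective. -/
theorem EndNilpotentOrBijective.isSimpleModule [IsSemisimpleModule Λ X] [Nontrivial X]
    (h : EndNilpotentOrBijective Λ X) : IsSimpleModule Λ X := by
  obtain ⟨m, hm⟩ := IsSemisimpleModule.exists_simple_submodule Λ X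
  obtain ⟨r, hr⟩ := IsSemisimpleModule.extension_property m.subtype
    (Submodule.injective_subtype _) LinearMap.id
  have hr' (x : m) : r x = x := LinearMap.congr_fun hr x
  have := IsSimpleModule.nontrivial Λ m
  rcases h (m.subtype ∘ₗ r) with ⟨k, hk⟩ | hb
  · obtain ⟨x, hx⟩ := exists_ne (0 : m)
    have hpk : ∀ k, ((m.subtype ∘ₗ r : Module.End Λ X) ^ k) x = x := by
      intro k
      induction k with
      | zero => rfl
      | succ k ih => rw [pow_succ, Module.End.mul_apply]; simpa [hr'] using ih
    refine absurd ?_ hx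
    have := hpk k
    rw [hk] at this
    exact Subtype.ext this.symm
  · have : m = ⊤ := eq_top_iff.2 fun x _ => by
      obtain ⟨y, rfl⟩ := hb.2 x
      exact (r y).2
    subst this
    exact IsSimpleModule.congr Submodule.topEquiv.symm

end EndNilpotentOrBijective

/-! ### Projective covers -/

section ProjectiveCover

variable {Λ : Type u} [Ring Λ]

theorem IsProjectiveCover.finite {P M : ModuleCat.{u} Λ} {f : P →ₗ[Λ] M}
    (hf : IsProjectiveCover f) [Module.Finite Λ M] : Module.Finite Λ P := by
  obtain ⟨n, g, hg⟩ := Module.Finite.exists_fin' Λ M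
  obtain ⟨k, hk⟩ := Module.projective_lifting_property f g hf.surjective
  have : LinearMap.range k = ⊤ := hf.superfluous _ (eq_top_iff.2 fun x _ => by
    obtain ⟨y, hy⟩ := hg (f x)
    rw [← sub_add_cancel x (k y), add_comm]
    refine Submodule.add_mem_sup ⟨y, rfl⟩ ?_
    rw [LinearMap.mem_ker, map_sub, ← hy, sub_eq_zero, ← hk, LinearMap.comp_apply])
  exact Module.Finite.of_surjective k (LinearMap.range_eq_top.1 this)

theorem IsProjectiveCover.ker_le [IsArtinianRing Λ] {P M : ModuleCat.{u} Λ} {f : P →ₗ[Λ] M}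
    (hf : IsProjectiveCover f) : LinearMap.ker f ≤ Ring.jacobson Λ • ⊤ :=
  le_jacobson_smul_top_of_superfluous hf.superfluous

/-- Take a minimal projective submodule `Q` of a free module that still maps onto `M`. If `N`
supplements the kernel, lifting gives an endomorphism `φ` of `Q` with image in `N` and compatible
with `f`. -/
theorem exists_isProjectiveCover [IsArtinianRing Λ] (M : ModuleCat.{u} Λ) [Module.Finite Λ M] :
    ∃ (P : ModuleCat.{u} Λ) (f : P →ₗ[Λ] M), IsProjectiveCover f := by
  obtain ⟨n, g, hg⟩ := Module.Finite.exists_fin' Λ M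
  obtain ⟨Q, ⟨hQ, hgQ⟩, hmin⟩ := IsArtinian.set_has_minimal
    {Q : Submodule Λ (Fin n → Λ) | Module.Projective Λ Q ∧ Q.map g = ⊤}
    ⟨⊤, Module.Projective.of_equiv Submodule.topEquiv.symm, by
      rw [Submodule.map_top, LinearMap.range_eq_top.2 hg]⟩
  let f : Q →ₗ[Λ] M := g ∘ₗ Q.subtype
  have hf : Function.Surjective f := fun m => by
    obtain ⟨x, hx, rfl⟩ : m ∈ Q.map g := hgQ ▸ trivial
    exact ⟨⟨x, hx⟩, rfl⟩
  refine ⟨ModuleCat.of Λ Q, f, hQ, hf, fun N hN => ?_⟩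
  have hfN : Function.Surjective (f ∘ₗ N.subtype) := fun m => by
    obtain ⟨x, rfl⟩ := hf m
    obtain ⟨y, hy, z, hz, rfl⟩ := Submodule.mem_sup.1 (hN.symm ▸ trivial : x ∈ N ⊔ LinearMap.ker f)
    exact ⟨⟨y, hy⟩, by simp [LinearMap.mem_ker.1 hz]⟩
  obtain ⟨k, hk⟩ := Module.projective_lifting_property (f ∘ₗ N.subtype) f hfN
  let φ : Module.End Λ Q := N.subtype ∘ₗ k
  have hφ : ∀ r x, f ((φ ^ r) x) = f x := fun r => by
    induction r with
    | zero => exact fun _ => rfl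
    | succ r ih => exact fun x => (ih (φ x)).trans (LinearMap.congr_fun hk x)
  -- By Fitting the image of `φ ^ r` is a summand, hence projective, and it still covers `M`;
  -- minimality makes it all of `Q`. The bound `1 ≤ r` places that image inside `N`.
  obtain ⟨r, hr, hr1⟩ := (φ.eventually_isCompl_ker_pow_range_pow.and
    (Filter.eventually_ge_atTop 1)).exists
  have hproj : Module.Projective Λ (LinearMap.range (φ ^ r)) :=
    Module.Projective.of_split (LinearMap.range (φ ^ r)).subtype
      (Submodule.projectionOnto _ _ hr.symm) (by ext; simp)
  have hle : (LinearMap.range (φ ^ r)).map Q.subtype ≤ Q := Submodule.map_subtype_le _ _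
  have hnlt := hmin ((LinearMap.range (φ ^ r)).map Q.subtype)
    ⟨Module.Projective.of_equiv (Submodule.equivMapOfInjective _ Q.injective_subtype _),
      eq_top_iff.2 fun m _ => by
        obtain ⟨x, rfl⟩ := hf m
        exact ⟨_, ⟨_, ⟨x, rfl⟩, rfl⟩, hφ r x⟩⟩
  have heq := hle.antisymm (not_lt_iff_le_imp_ge.1 hnlt hle)
  refine eq_top_iff.2 fun x _ => ?_
  obtain ⟨y, ⟨z, rfl⟩, hy⟩ : (x : Fin n → Λ) ∈ (LinearMap.range (φ ^ r)).map Q.subtype :=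
    heq.ge x.2
  obtain ⟨r, rfl⟩ := Nat.exists_eq_add_of_le hr1
  have hxy : x = N.subtype (k ((φ ^ r) z)) := by
    rw [pow_add, pow_one] at hy
    exact Subtype.ext hy.symm
  exact hxy ▸ (k ((φ ^ r) z)).2

variable {K : Type v} [Field K] [Algebra K Λ] {ν : Λ →ₗ[K] K}

/-- Syzygies stay indecomposable. An endomorphism `e` of the kernel extends to `φ` on `P`, which
induces `ψ` on `M`. If `ψ` is nilpotent, a power of `φ` maps `P` into `J P`, so `φ` is nilpotent. If
`ψ` is bijective, `φ` is onto by Nakayama, hence injective, and so is `e`. -/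
theorem IsSymmetrizing.endNilpotentOrBijective_ker [Module.Finite K Λ] (hν : IsSymmetrizing ν)
    (hnil : IsNilpotent (Ring.jacobson Λ))
    {P M : Type*} [AddCommGroup P] [Module Λ P] [Module K P] [IsScalarTower K Λ P]
    [Module.Finite Λ P] [Module.Projective Λ P] [AddCommGroup M] [Module Λ M]
    (hM : EndNilpotentOrBijective Λ M) (f : P →ₗ[Λ] M) (hf : Function.Surjective f)
    (hker : LinearMap.ker f ≤ Ring.jacobson Λ • ⊤) :
    EndNilpotentOrBijective Λ (LinearMap.ker f) := by
  have := IsArtinianRing.of_finite K Λ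
  intro e
  obtain ⟨φ, hφ⟩ := hν.exists_extend (LinearMap.ker f).subtype (Submodule.injective_subtype _)
    ((LinearMap.ker f).subtype ∘ₗ e)
  have hφ' (x : LinearMap.ker f) : φ x = e x := hφ x
  have hpow (r : ℕ) (x : LinearMap.ker f) : (φ ^ r) x = (e ^ r) x := by
    induction r with
    | zero => rfl
    | succ r ih =>
      rw [pow_succ', pow_succ', Module.End.mul_apply, Module.End.mul_apply, ih, hφ']
  let q := f.quotKerEquivOfSurjective hf
  let ψ : Module.End Λ M := ((LinearMap.ker f).liftQ (f ∘ₗ φ) fun x hx => by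
    have := (e ⟨x, hx⟩).2
    rw [← hφ'] at this
    exact this) ∘ₗ q.symm.toLinearMap
  have hψ (x : P) : ψ (f x) = f (φ x) := by
    have : q.symm (f x) = Submodule.Quotient.mk x := by
      rw [LinearEquiv.symm_apply_eq]; rfl
    rw [LinearMap.comp_apply, LinearEquiv.coe_coe, this]
    rfl
  have hψpow (r : ℕ) (x : P) : (ψ ^ r) (f x) = f ((φ ^ r) x) := by
    induction r with
    | zero => rfl
    | succ r ih =>
      rw [pow_succ', pow_succ', Module.End.mul_apply, Module.End.mul_apply, ih, hψ]
  rcases hM ψ with ⟨r, hr⟩ | hb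
  · left
    obtain ⟨n, hn⟩ := hnil
    have hmem (x : P) : (φ ^ r) x ∈ Ring.jacobson Λ • (⊤ : Submodule Λ P) :=
      hker (by rw [LinearMap.mem_ker, ← hψpow, hr]; rfl)
    have hmem' : ∀ m, ∀ x : P, ((φ ^ r) ^ m) x ∈ Ring.jacobson Λ ^ m • (⊤ : Submodule Λ P) := by
      intro m
      induction m with
      | zero => intro x; rw [Submodule.pow_zero, Ideal.one_eq_top, Submodule.top_smul]; trivial
      | succ m ih =>
        intro x
        have h1 := Submodule.mem_map_of_mem (f := φ ^ r) (ih x)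
        rw [Submodule.map_smul''] at h1
        rw [pow_succ' (φ ^ r), Module.End.mul_apply, Submodule.pow_succ, Submodule.mul_smul]
        refine Submodule.smul_mono le_rfl ?_ h1
        rintro _ ⟨y, -, rfl⟩
        exact hmem y
    refine ⟨r * n, LinearMap.ext fun x => Subtype.ext ?_⟩
    rw [← hpow, pow_mul]
    have := hmem' n x
    rw [hn] at this
    simpa using this
  · right
    have hsurj : Function.Surjective φ := by
      rw [← LinearMap.range_eq_top]
      refine eq_top_of_sup_eq_top_of_le hker (eq_top_iff.2 fun x _ => ?_)
      obtain ⟨m, hm⟩ := hb.2 (f x)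
      obtain ⟨y, rfl⟩ := hf m
      rw [← sub_add_cancel x (φ y), add_comm]
      refine Submodule.add_mem_sup ⟨y, rfl⟩ ?_
      rw [LinearMap.mem_ker, map_sub, ← hm, hψ, sub_self]
    have hinj : Function.Injective φ := (IsNoetherian.bijective_of_surjective_endomorphism φ hsurj).1
    refine IsArtinian.bijective_of_injective_endomorphism e fun x y hxy => ?_
    refine Subtype.ext (hinj ?_)
    rw [hφ', hφ', hxy]

end ProjectiveCover

/-! ### First extension groups from projective presentations -/

section ExtOne

open scoped ModuleCat

variable {K : Type v} [Field K] {Λ : Type u} [Ring Λ] [Algebra K Λ]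

/-- In the long exact sequence `Ext¹(P, T)` vanishes, and `hT` says that restriction from `P` to the
kernel is zero, so the connecting map is an isomorphism. -/
theorem finrank_ext_one_eq_homDim {P M T : ModuleCat.{u} Λ} (f : P →ₗ[Λ] M)
    (hP : Module.Projective Λ P) (hf : Function.Surjective f)
    (hT : ∀ g : P →ₗ[Λ] T, LinearMap.ker f ≤ LinearMap.ker g) :
    Module.finrank K (Abelian.Ext M T 1) = homDim K Λ (LinearMap.ker f) T := by
  have hS := LinearMap.shortExact_shortComplexKer hf
  have : Projective P := (IsProjective.iff_projective P).1 hP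
  let δ : (ModuleCat.of Λ (LinearMap.ker f) ⟶ T) →ₗ[K] Abelian.Ext M T 1 :=
    (Abelian.Ext.precompOfLinear hS.extClass K T (add_zero 1)) ∘ₗ
      (Abelian.Ext.linearEquiv₀ (R := K)).symm.toLinearMap
  have hinj : Function.Injective δ := by
    rw [injective_iff_map_eq_zero]
    intro g hg
    obtain ⟨x, hx⟩ := Abelian.Ext.contravariant_sequence_exact₁ hS T
      (Abelian.Ext.linearEquiv₀ (R := K).symm g) (add_zero 1) hg
    obtain ⟨k, rfl⟩ := (Abelian.Ext.linearEquiv₀ (R := K)).symm.surjective x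
    rw [Abelian.Ext.linearEquiv₀_symm_apply, Abelian.Ext.linearEquiv₀_symm_apply,
      Abelian.Ext.mk₀_comp_mk₀] at hx
    obtain rfl := (Abelian.Ext.mk₀_bijective _ _).1 hx
    ext y
    exact hT k.hom y.2
  have hsurj : Function.Surjective δ := by
    intro x
    obtain ⟨y, hy⟩ := Abelian.Ext.contravariant_sequence_exact₃ hS T x
      (Abelian.Ext.eq_zero_of_projective _) (add_zero 1)
    obtain ⟨k, rfl⟩ := (Abelian.Ext.linearEquiv₀ (R := K)).symm.surjective y
    exact ⟨k, hy⟩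
  rw [← (LinearEquiv.ofBijective δ ⟨hinj, hsurj⟩).finrank_eq,
    (ModuleCat.homLinearEquiv (S := K)).finrank_eq]
  rfl

end ExtOne

/-! ### Radical layers of projective modules -/

section Layers

variable {K : Type v} [Field K] {Λ : Type u} [Ring Λ] [Algebra K Λ]

theorem finite_submodule {X : Type*} [AddCommGroup X] [Module Λ X] [Module K X]
    [IsScalarTower K Λ X] [Module.Finite K X] (N : Submodule Λ X) : Module.Finite K N :=
  inferInstanceAs (Module.Finite K (N.restrictScalars K))

theorem smul_top_prod (I : Ideal Λ) (X Y : Type*) [AddCommGroup X] [Module Λ X]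
    [AddCommGroup Y] [Module Λ Y] : I • (⊤ : Submodule Λ (X × Y)) =
      (I • (⊤ : Submodule Λ X)).prod (I • (⊤ : Submodule Λ Y)) := by
  refine le_antisymm (Submodule.smul_le.2 fun a ha x _ =>
    ⟨Submodule.smul_mem_smul ha trivial, Submodule.smul_mem_smul ha trivial⟩) ?_
  rintro ⟨x, y⟩ ⟨hx, hy⟩
  have h1 := map_smul_top_le I (LinearMap.inl Λ X Y) (Submodule.mem_map_of_mem hx)
  have h2 := map_smul_top_le I (LinearMap.inr Λ X Y) (Submodule.mem_map_of_mem hy)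
  simpa using add_mem h1 h2

/-- An isomorphism of modules restricts to the submodules `I • ⊤`. -/
def smulTopEquiv {X Y : Type*} [AddCommGroup X] [Module Λ X] [AddCommGroup Y] [Module Λ Y]
    (I : Ideal Λ) (e : X ≃ₗ[Λ] Y) :
    (I • (⊤ : Submodule Λ X) : Submodule Λ X) ≃ₗ[Λ] (I • (⊤ : Submodule Λ Y) : Submodule Λ Y) :=
  (e.submoduleMap _).trans
    (LinearEquiv.ofEq _ _ (map_smul_top_of_surjective I e.toLinearMap e.surjective))

theorem homDim_smul_top_prod (I : Ideal Λ) (X Y T : Type*) [AddCommGroup X] [Module Λ X]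
    [Module K X] [IsScalarTower K Λ X] [Module.Finite K X]
    [AddCommGroup Y] [Module Λ Y] [Module K Y] [IsScalarTower K Λ Y] [Module.Finite K Y]
    [AddCommGroup T] [Module Λ T] [Module K T] [IsScalarTower K Λ T] [Module.Finite K T] :
    homDim K Λ (I • (⊤ : Submodule Λ (X × Y)) : Submodule Λ (X × Y)) T =
      homDim K Λ (I • (⊤ : Submodule Λ X) : Submodule Λ X) T +
      homDim K Λ (I • (⊤ : Submodule Λ Y) : Submodule Λ Y) T := by
  have := finite_submodule (K := K) (I • (⊤ : Submodule Λ X))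
  have := finite_submodule (K := K) (I • (⊤ : Submodule Λ Y))
  rw [← homDim_prod]
  let e : ((I • (⊤ : Submodule Λ X)).prod (I • (⊤ : Submodule Λ Y)) : Submodule Λ (X × Y)) ≃ₗ[Λ]
      (I • (⊤ : Submodule Λ X) : Submodule Λ X) × (I • (⊤ : Submodule Λ Y) : Submodule Λ Y) :=
    { toFun := fun x => (⟨x.1.1, x.2.1⟩, ⟨x.1.2, x.2.2⟩)
      invFun := fun x => ⟨(x.1, x.2), x.1.2, x.2.2⟩
      map_add' := fun _ _ => rfl
      map_smul' := fun _ _ => rfl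
      left_inv := fun _ => rfl
      right_inv := fun _ => rfl }
  exact homDim_congr_left ((LinearEquiv.ofEq _ _ (smul_top_prod I X Y)).trans e)

end Layers

namespace IsOfDiagramType

open scoped ModuleCat

variable {K : Type v} [Field K] {Λ : Type u} [Ring Λ] [Algebra K Λ] {n : ℕ}
  {D : Matrix (Fin n) (Fin n) ℕ} {S : Fin n → ModuleCat.{u} Λ}

theorem isArtinianRing (h : IsOfDiagramType K D S) : IsArtinianRing Λ :=
  have := h.algebra.finite
  IsArtinianRing.of_finite K Λ

theorem finite_simple (h : IsOfDiagramType K D S) (i : Fin n) : Module.Finite K (S i) := by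
  have := h.algebra.finite
  have := h.simples.simple i
  exact finite_of_finite_of_finite (Λ := Λ) (S i)

theorem homDim_simple [IsAlgClosed K] (h : IsOfDiagramType K D S) (i j : Fin n) :
    homDim K Λ (S i) (S j) = if i = j then 1 else 0 := by
  have := h.simples.simple i
  have := h.simples.simple j
  have := h.finite_simple j
  split_ifs with hij
  · subst hij
    exact homDim_self_of_isSimpleModule
  · exact homDim_eq_zero_of_isEmpty ⟨fun e => hij (h.simples.injective i j ⟨e.toModuleIso⟩)⟩

theorem exists_linearEquiv (h : IsOfDiagramType K D S) (T : Type u) [AddCommGroup T] [Module Λ T]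
    [IsSimpleModule Λ T] : ∃ i, Nonempty (T ≃ₗ[Λ] S i) := by
  obtain ⟨i, ⟨e⟩⟩ := h.simples.complete (ModuleCat.of Λ T) inferInstance
  exact ⟨i, ⟨e.toLinearEquiv⟩⟩

theorem mul_mul_eq_zero (h : IsOfDiagramType K D S) {a b c : Λ} (ha : a ∈ Ring.jacobson Λ)
    (hb : b ∈ Ring.jacobson Λ) (hc : c ∈ Ring.jacobson Λ) : a * b * c = 0 := by
  have h3 := h.algebra.rad_cube
  rw [Submodule.pow_succ, Submodule.pow_succ, Submodule.pow_one] at h3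
  have := Submodule.mul_mem_mul (Submodule.mul_mem_mul ha hb) hc
  rwa [h3, Submodule.mem_bot] at this

theorem isNilpotent_jacobson (h : IsOfDiagramType K D S) : IsNilpotent (Ring.jacobson Λ) :=
  ⟨3, h.algebra.rad_cube⟩

theorem smul_smul_top_le_radSocle (h : IsOfDiagramType K D S) (X : Type*) [AddCommGroup X]
    [Module Λ X] :
    Ring.jacobson Λ • Ring.jacobson Λ • (⊤ : Submodule Λ X) ≤ radSocle Λ X := by
  refine Submodule.smul_le.2 fun b hb y hy a ha => ?_
  refine Submodule.smul_induction_on hy (fun c hc z _ => ?_) fun y z hy hz => ?_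
  · rw [smul_smul, smul_smul, h.mul_mul_eq_zero ha hb hc, zero_smul]
  · rw [smul_add, smul_add, hy, hz, add_zero]

section Cover

variable {i : Fin n} {P : ModuleCat.{u} Λ} {f : P →ₗ[Λ] S i}

theorem ker_cover (h : IsOfDiagramType K D S) (hf : IsProjectiveCover f) :
    LinearMap.ker f = Ring.jacobson Λ • ⊤ := by
  have := h.isArtinianRing
  have := h.simples.simple i
  exact hf.ker_le.antisymm (jacobson_smul_top_le_ker f)

theorem homDim_cover [IsAlgClosed K] (h : IsOfDiagramType K D S) (hf : IsProjectiveCover f)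
    (j : Fin n) : homDim K Λ P (S j) = if i = j then 1 else 0 := by
  have := h.simples.simple j
  rw [← h.homDim_simple, ← homDim_quotient (LinearMap.ker f) fun g => by
    rw [h.ker_cover hf]; exact jacobson_smul_top_le_ker g]
  exact homDim_congr_left (f.quotKerEquivOfSurjective hf.surjective)

theorem homDim_radical_cover (h : IsOfDiagramType K D S) (hf : IsProjectiveCover f) (j : Fin n) :
    homDim K Λ (Ring.jacobson Λ • (⊤ : Submodule Λ P) : Submodule Λ P) (S j) = D i j := by
  have := h.simples.simple j
  rw [← h.ext_dim, finrank_ext_one_eq_homDim f hf.projective hf.surjective fun g => by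
    rw [h.ker_cover hf]; exact jacobson_smul_top_le_ker g]
  exact homDim_congr_left (LinearEquiv.ofEq _ _ (h.ker_cover hf).symm)

end Cover

/-- Both sides are additive; induction on the dimension splits off the projective cover of a simple
quotient of `Q`, for which the formula is the `Ext¹` condition. -/
theorem homDim_radical_projective [IsAlgClosed K] (h : IsOfDiagramType K D S) (j : Fin n) (d : ℕ) :
    ∀ (Q : Type u) [AddCommGroup Q] [Module Λ Q] [Module K Q] [IsScalarTower K Λ Q]
      [Module.Finite Λ Q] [Module.Projective Λ Q], Module.finrank K Q = d →
      homDim K Λ (Ring.jacobson Λ • (⊤ : Submodule Λ Q) : Submodule Λ Q) (S j) =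
        ∑ i, homDim K Λ Q (S i) * D i j := by
  induction d using Nat.strong_induction_on with
  | _ d ih =>
  intro Q _ _ _ _ _ _ hd
  have := h.algebra.finite
  have := h.isArtinianRing
  have hS := h.finite_simple
  have := finite_of_finite_of_finite (K := K) (Λ := Λ) Q
  rcases subsingleton_or_nontrivial Q with hQ | hQ
  · have (T : Type u) [AddCommGroup T] [Module Λ T] [Module K T] [IsScalarTower K Λ T]
        (N : Submodule Λ Q) : homDim K Λ N T = 0 := by
      have : Subsingleton (N →ₗ[Λ] T) :=
        ⟨fun f g => LinearMap.ext fun x => by rw [Subsingleton.elim x 0, map_zero, map_zero]⟩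
      exact Module.finrank_zero_of_subsingleton
    rw [this, Finset.sum_eq_zero]
    intro i _
    rw [← homDim_congr_left (K := K) (T := S i) (Submodule.topEquiv (R := Λ) (M := Q)), this,
      zero_mul]
  obtain ⟨m, hm, -⟩ := (eq_top_or_exists_le_coatom (⊥ : Submodule Λ Q)).resolve_left bot_ne_top
  have := isSimpleModule_iff_isCoatom.2 hm
  obtain ⟨i, ⟨e⟩⟩ := h.exists_linearEquiv (Q ⧸ m)
  have := h.simples.simple i
  obtain ⟨P, f, hf⟩ := exists_isProjectiveCover (S i)
  have := hf.projective
  have := hf.finite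
  have := finite_of_finite_of_finite (K := K) (Λ := Λ) P
  obtain ⟨k, hk⟩ := Module.projective_lifting_property f (e.toLinearMap ∘ₗ m.mkQ) hf.surjective
  have hks : Function.Surjective k := by
    rw [← LinearMap.range_eq_top]
    refine hf.superfluous _ (eq_top_iff.2 fun x _ => ?_)
    obtain ⟨y, hy⟩ := (e.surjective.comp m.mkQ_surjective) (f x)
    rw [← sub_add_cancel x (k y), add_comm]
    refine Submodule.add_mem_sup ⟨y, rfl⟩ ?_
    rw [LinearMap.mem_ker, map_sub, ← hy, sub_eq_zero]
    exact (LinearMap.congr_fun hk y).symm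
  obtain ⟨s, hs⟩ := Module.projective_lifting_property k LinearMap.id hks
  have hs' (x : P) : k (s x) = x := LinearMap.congr_fun hs x
  let E : Q ≃ₗ[Λ] P × LinearMap.ker k := LinearEquiv.ofLinearMap
    (k.prod ((LinearMap.id - s ∘ₗ k).codRestrict _ fun x => by simp [hs']))
    (s.coprod (LinearMap.ker k).subtype) (by ext <;> simp [hs']) (by ext; simp)
  have hproj : Module.Projective Λ (LinearMap.ker k) :=
    Module.Projective.of_split (LinearMap.ker k).subtype
      ((LinearMap.id - s ∘ₗ k).codRestrict _ fun x => by simp [hs']) (by ext; simp)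
  have := finite_submodule (K := K) (LinearMap.ker k)
  have : Module.Finite Λ (LinearMap.ker k) := inferInstance
  have hP : Nontrivial P := by
    have := IsSimpleModule.nontrivial Λ (S i)
    exact hf.surjective.nontrivial
  have hlt : Module.finrank K (LinearMap.ker k) < d := by
    rw [← hd, (E.restrictScalars K).finrank_eq, Module.finrank_prod]
    have := Module.finrank_pos (R := K) (M := P)
    omega
  have h2 (l : Fin n) : homDim K Λ Q (S l) =
      (if i = l then 1 else 0) + homDim K Λ (LinearMap.ker k) (S l) := by
    rw [homDim_congr_left E, homDim_prod, h.homDim_cover hf]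
  rw [homDim_congr_left (smulTopEquiv (Ring.jacobson Λ) E), homDim_smul_top_prod,
    h.homDim_radical_cover hf, ih _ hlt _ rfl]
  simp [h2, add_mul, Finset.sum_add_distrib]

end IsOfDiagramType

namespace IsOfDiagramType

open scoped ModuleCat

variable {K : Type v} [Field K] {Λ : Type u} [Ring Λ] [Algebra K Λ] {n : ℕ}
  {D : Matrix (Fin n) (Fin n) ℕ} {S : Fin n → ModuleCat.{u} Λ}

/-! ### The socle of a projective module -/

/-- If `J² P = 0`, then `J P` is semisimple and contains `S k`; but `Hom(S k, P)` has the dimension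
of `Hom(P, S k)`, which is zero for `k ≠ i`. -/
theorem exists_smul_smul_ne_zero [IsAlgClosed K] (h : IsOfDiagramType K D S) {i k : Fin n}
    (hik : i ≠ k) (hD : D i k ≠ 0) {P : ModuleCat.{u} Λ} {f : P →ₗ[Λ] S i}
    (hf : IsProjectiveCover f) :
    ∃ a ∈ Ring.jacobson Λ, ∃ b ∈ Ring.jacobson Λ, ∃ x : P, a • b • x ≠ 0 := by
  by_contra! h0
  have := h.algebra.finite
  have := h.isArtinianRing
  have := h.simples.simple i
  have := h.simples.simple k
  have := h.finite_simple k
  have := hf.projective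
  have := hf.finite
  have := finite_of_finite_of_finite (K := K) (Λ := Λ) P
  obtain ⟨ν, hν⟩ := h.algebra.symmetric.exists_isSymmetrizing
  have := finite_submodule (K := K) (Ring.jacobson Λ • (⊤ : Submodule Λ P))
  have := isSemisimpleModule_of_le_radSocle (N := Ring.jacobson Λ • (⊤ : Submodule Λ P))
    (Submodule.smul_le.2 fun b hb x _ a ha => h0 a ha b hb x)
  have h1 := h.homDim_radical_cover hf k
  have h2 : homDim K Λ (S k) P = 0 := by
    rw [homDim, hν.finrank_hom_projective]
    exact (h.homDim_cover hf k).trans (if_neg hik)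
  have := finite_hom_of_finite (K := K) (Λ := Λ) (S k) P
  have h3 : Subsingleton (S k →ₗ[Λ] P) := Module.finrank_zero_iff.1 h2
  have h4 : Subsingleton (S k →ₗ[Λ] (Ring.jacobson Λ • (⊤ : Submodule Λ P) : Submodule Λ P)) :=
    ⟨fun g g' => LinearMap.ext fun x => Subtype.ext (LinearMap.congr_fun
      (Subsingleton.elim ((Submodule.subtype _) ∘ₗ g) ((Submodule.subtype _) ∘ₗ g')) x)⟩
  rw [homDim_comm] at h1
  exact hD (h1.symm.trans Module.finrank_zero_of_subsingleton)

/-- If `x` is outside `J`, the ideal `I` of elements killed by `J²` acts nontrivially on some `S i`.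
Then `I P = P` for its cover `P`, so `J² P = 0`, which a neighbour of `i` excludes. -/
theorem mem_jacobson_of_mul_mul_eq_zero [IsAlgClosed K] (h : IsOfDiagramType K D S)
    (hD : ∀ i, ∃ k, i ≠ k ∧ D i k ≠ 0) {x : Λ}
    (hx : ∀ a ∈ Ring.jacobson Λ, ∀ b ∈ Ring.jacobson Λ, a * b * x = 0) :
    x ∈ Ring.jacobson Λ := by
  have := h.algebra.finite
  have := h.isArtinianRing
  by_contra hxJ
  obtain ⟨m, hm, hxm⟩ : ∃ m : Ideal Λ, m.IsMaximal ∧ x ∉ m := by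
    rw [Ring.jacobson_eq_sInf_isMaximal, Ideal.mem_sInf] at hxJ
    push Not at hxJ
    exact hxJ
  have := isSimpleModule_iff_isCoatom.2 hm.out
  obtain ⟨i, ⟨e⟩⟩ := h.exists_linearEquiv (Λ ⧸ m)
  have := h.simples.simple i
  obtain ⟨k, hik, hDk⟩ := hD i
  obtain ⟨P, f, hf⟩ := exists_isProjectiveCover (S i)
  have := hf.finite
  let I : Ideal Λ :=
    { carrier := {y | ∀ a ∈ Ring.jacobson Λ, ∀ b ∈ Ring.jacobson Λ, a * b * y = 0}
      add_mem' := fun hy hz a ha b hb => by rw [mul_add, hy a ha b hb, hz a ha b hb, add_zero]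
      zero_mem' := fun _ _ _ _ => mul_zero _
      smul_mem' := fun c y hy a ha b hb => by
        rw [smul_eq_mul, ← mul_assoc, mul_assoc a, hy a ha _ (Ideal.mul_mem_right c _ hb)] }
  have hI : I • (⊤ : Submodule Λ (S i)) = ⊤ := by
    refine (eq_bot_or_eq_top _).resolve_left fun h0 => hxm ?_
    have h1 : x • e (Submodule.Quotient.mk 1) ∈ I • (⊤ : Submodule Λ (S i)) :=
      Submodule.smul_mem_smul (I := I) hx trivial
    rw [h0, Submodule.mem_bot, ← map_smul, LinearEquiv.map_eq_zero_iff,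
      ← Submodule.Quotient.mk_smul, Submodule.Quotient.mk_eq_zero, smul_eq_mul, mul_one] at h1
    exact h1
  have hIP : I • (⊤ : Submodule Λ P) = ⊤ := by
    refine hf.superfluous _ ?_
    have h1 := map_smul_top_of_surjective I f hf.surjective
    rw [hI] at h1
    rw [← Submodule.comap_map_eq, h1, Submodule.comap_top]
  obtain ⟨a, ha, b, hb, p, hp⟩ := h.exists_smul_smul_ne_zero hik hDk hf
  refine hp (Submodule.smul_induction_on (hIP.ge trivial : p ∈ I • (⊤ : Submodule Λ P))
    (fun y hy q _ => ?_) fun y z hy hz => ?_)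
  · rw [smul_smul, smul_smul, hy a ha b hb, zero_smul]
  · rw [smul_add, smul_add, hy, hz, add_zero]

/-- A form vanishing on `J²` but not at `x` is `ν (· b)` with `J² b = 0`. Hence `b ∈ J`, and `J x =
0` gives `ν (x b) = ν (b x) = 0`, a contradiction. -/
theorem radSocle_self_le [IsAlgClosed K] (h : IsOfDiagramType K D S)
    (hD : ∀ i, ∃ k, i ≠ k ∧ D i k ≠ 0) :
    radSocle Λ Λ ≤ Ring.jacobson Λ • Ring.jacobson Λ • ⊤ := by
  have := h.algebra.finite
  obtain ⟨ν, hν⟩ := h.algebra.symmetric.exists_isSymmetrizing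
  intro x hx
  by_contra hxR
  obtain ⟨l, hlx, hl⟩ := Submodule.exists_le_ker_of_notMem (K := K)
    (p := (Ring.jacobson Λ • Ring.jacobson Λ • (⊤ : Submodule Λ Λ)).restrictScalars K) hxR
  obtain ⟨b, hb⟩ := hν.exists_mul_eq l
  have hbJ : b ∈ Ring.jacobson Λ := by
    refine h.mem_jacobson_of_mul_mul_eq_zero hD fun a ha c hc => hν.nondeg _ fun d => ?_
    rw [← mul_assoc, hb]
    refine hl ?_
    have : (d * a) * (c * 1) ∈ Ring.jacobson Λ • Ring.jacobson Λ • (⊤ : Submodule Λ Λ) :=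
      Submodule.smul_mem_smul (Ideal.mul_mem_left _ d ha) (Submodule.smul_mem_smul hc trivial)
    rwa [mul_one, mul_assoc] at this
  refine hlx ?_
  rw [← hb, hν.symm, ← smul_eq_mul, hx b hbJ, map_zero]

theorem radSocle_projective [IsAlgClosed K] (h : IsOfDiagramType K D S)
    (hD : ∀ i, ∃ k, i ≠ k ∧ D i k ≠ 0) (P : Type*) [AddCommGroup P] [Module Λ P]
    [Module.Finite Λ P] [Module.Projective Λ P] :
    radSocle Λ P = Ring.jacobson Λ • Ring.jacobson Λ • ⊤ := by
  refine le_antisymm (fun x hx => ?_) (h.smul_smul_top_le_radSocle P)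
  obtain ⟨m, i, p, hip⟩ := exists_retract_of_projective (Λ := Λ) P
  rw [← hip x, ← Finset.univ_sum_single (i x), map_sum]
  refine sum_mem fun a _ => ?_
  have h1 := h.radSocle_self_le hD (map_mem_radSocle (LinearMap.proj a ∘ₗ i) hx)
  have h2 := Submodule.mem_map_of_mem (f := p ∘ₗ LinearMap.single Λ (fun _ => Λ) a) h1
  rw [Submodule.map_smul'', Submodule.map_smul''] at h2
  exact Submodule.smul_mono le_rfl (Submodule.smul_mono le_rfl le_top) h2

end IsOfDiagramType

/-! ### Radical layers of syzygies and the resulting recurrence. -/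

section HasLayers

open scoped ModuleCat in
/-- `M` is a finite module with no proper decomposition whose radical is semisimple; `t` and `s`
are the multiplicities of the simple modules in `M / rad M` and in `rad M`. -/
structure HasLayers (K : Type v) [Field K] {Λ : Type u} [Ring Λ] [Algebra K Λ] {n : ℕ}
    (S : Fin n → ModuleCat.{u} Λ) (M : Type u) [AddCommGroup M] [Module Λ M]
    (t s : Fin n → ℕ) : Prop where
  finite : Module.Finite Λ M
  endo : EndNilpotentOrBijective Λ M
  radical_le : Ring.jacobson Λ • (⊤ : Submodule Λ M) ≤ radSocle Λ M
  top : ∀ j, homDim K Λ M (S j) = t j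
  radical : ∀ j, homDim K Λ (Ring.jacobson Λ • (⊤ : Submodule Λ M) : Submodule Λ M) (S j) = s j

open scoped ModuleCat

variable {K : Type v} [Field K] {Λ : Type u} [Ring Λ] [Algebra K Λ] {n : ℕ}
  {D : Matrix (Fin n) (Fin n) ℕ} {S : Fin n → ModuleCat.{u} Λ}

theorem HasLayers.congr {M N : Type u} [AddCommGroup M] [Module Λ M] [AddCommGroup N] [Module Λ N]
    {t s : Fin n → ℕ} (h : HasLayers K S M t s) (e : M ≃ₗ[Λ] N) : HasLayers K S N t s where
  finite := have := h.finite; Module.Finite.equiv e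
  endo := h.endo.congr e
  radical_le := by
    rw [← map_smul_top_of_surjective _ e.toLinearMap e.surjective]
    rintro _ ⟨x, hx, rfl⟩
    exact map_mem_radSocle e.toLinearMap (h.radical_le hx)
  top j := by rw [← h.top, homDim_congr_left e]
  radical j := by rw [← h.radical, homDim_congr_left (smulTopEquiv _ e)]

namespace IsOfDiagramType

theorem hasLayers_simple [IsAlgClosed K] (h : IsOfDiagramType K D S) (i : Fin n) :
    HasLayers K S (S i) (Pi.single i 1) 0 := by
  have := h.simples.simple i
  have h0 : Ring.jacobson Λ • (⊤ : Submodule Λ (S i)) = ⊥ := le_bot_iff.1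
    ((jacobson_smul_top_le_ker LinearMap.id).trans LinearMap.ker_id.le)
  refine ⟨inferInstance, .of_isSimpleModule, h0 ▸ bot_le, fun j => ?_, fun j => ?_⟩
  · rw [h.homDim_simple, Pi.single_apply]
    simp [eq_comm]
  · rw [h0]
    have : Subsingleton ((⊥ : Submodule Λ (S i)) →ₗ[Λ] S j) :=
      ⟨fun f g => LinearMap.ext fun x => by rw [Subsingleton.elim x 0, map_zero, map_zero]⟩
    exact Module.finrank_zero_of_subsingleton

theorem subsingleton_of_homDim_eq_zero (h : IsOfDiagramType K D S) (X : Type u) [AddCommGroup X]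
    [Module Λ X] [Module K X] [IsScalarTower K Λ X] [Module.Finite K X] [IsSemisimpleModule Λ X]
    (h0 : ∀ j, homDim K Λ X (S j) = 0) : Subsingleton X := by
  by_contra hX
  rw [not_subsingleton_iff_nontrivial] at hX
  obtain ⟨m, hm⟩ := IsSemisimpleModule.exists_simple_submodule Λ X
  obtain ⟨j, ⟨e⟩⟩ := h.exists_linearEquiv m
  have := h.simples.simple j
  have := h.finite_simple j
  have := finite_hom_of_finite (K := K) (Λ := Λ) X (S j)
  obtain ⟨r, hr⟩ := IsSemisimpleModule.extension_property m.subtype m.injective_subtype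
    e.toLinearMap
  have hs : Subsingleton (X →ₗ[Λ] S j) := Module.finrank_zero_iff.1 (h0 j)
  have := IsSimpleModule.nontrivial Λ m
  obtain ⟨x, hx⟩ := exists_ne (0 : m)
  refine hx (e.map_eq_zero_iff.1 ?_)
  rw [← LinearEquiv.coe_coe, ← hr, Subsingleton.elim r 0]
  rfl

/-- The layers of the kernel of a projective cover. -/
theorem layers_ker [IsAlgClosed K] (h : IsOfDiagramType K D S)
    (hD : ∀ i, ∃ k, i ≠ k ∧ D i k ≠ 0) {P M : ModuleCat.{u} Λ} {t s q : Fin n → ℕ}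
    (hM : HasLayers K S M t s) {f : P →ₗ[Λ] M} (hf : IsProjectiveCover f)
    (hq : ∀ j, q j + s j = ∑ i, t i * D i j) :
    (q ≠ 0 → HasLayers K S (LinearMap.ker f) q t ∧ ¬ IsSimpleModule Λ (LinearMap.ker f)) ∧
    (q = 0 → t ≠ 0 → ∃ l, t = Pi.single l 1 ∧ Nonempty (LinearMap.ker f ≃ₗ[Λ] S l)) := by
  have := h.algebra.finite
  have := h.isArtinianRing
  have hSs := h.simples.simple
  have hSf := h.finite_simple
  obtain ⟨ν, hν⟩ := h.algebra.symmetric.exists_isSymmetrizing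
  have := hM.finite
  have := hf.finite
  have := hf.projective
  have := finite_of_finite_of_finite (K := K) (Λ := Λ) P
  have := finite_of_finite_of_finite (K := K) (Λ := Λ) M
  have hfs := hf.surjective
  set J := Ring.jacobson Λ with hJ
  set N := LinearMap.ker f with hN
  have hNfin := finite_submodule (K := K) N
  have hNR1 : N ≤ J • ⊤ := hf.ker_le
  have hsoc : radSocle Λ P = J • J • ⊤ := h.radSocle_projective hD P
  have hsocN : radSocle Λ P ≤ N := by
    rw [hsoc, hN, LinearMap.le_ker_iff_map, Submodule.map_smul'', Submodule.map_smul'',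
      Submodule.map_top, LinearMap.range_eq_top.2 hfs, ← le_bot_iff]
    exact Submodule.smul_le.2 fun a ha x hx => hM.radical_le hx a ha
  have htP (j : Fin n) : homDim K Λ P (S j) = t j := by
    rw [← hM.top, ← homDim_quotient N fun g => hNR1.trans (jacobson_smul_top_le_ker g)]
    exact homDim_congr_left (f.quotKerEquivOfSurjective hfs)
  -- The socle of `N` is that of `P`, whose multiplicities equal those of the top of `P`.
  have hgN (j : Fin n) : homDim K Λ (S j) N = t j := by
    rw [homDim_submodule N fun g => (range_le_radSocle g).trans hsocN, ← htP]
    exact hν.finrank_hom_projective P (S j)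
  have hEnd : EndNilpotentOrBijective Λ N :=
    hν.endNilpotentOrBijective_ker h.isNilpotent_jacobson hM.endo f hfs hNR1
  -- the semisimple quotient `rad P / rad² P` and its submodule `N / rad² P`
  let R : Submodule Λ P := J • ⊤
  have hRfin := finite_submodule (K := K) R
  let R' : Submodule Λ R := J • ⊤
  have hR' : IsSemisimpleModule Λ (R ⧸ R') := isSemisimpleModule_quotient le_rfl
  have hmemR' (x : R) : x ∈ R' ↔ (x : P) ∈ radSocle Λ P := by
    have : R'.map R.subtype = radSocle Λ P := by
      rw [hsoc, Submodule.map_smul'', Submodule.map_top, Submodule.range_subtype]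
    rw [← this]
    exact ⟨fun hx => ⟨x, hx, rfl⟩, fun ⟨y, hy, hyx⟩ => Subtype.ext hyx ▸ hy⟩
  let JM : Submodule Λ M := J • ⊤
  have hJM : IsSemisimpleModule Λ JM := isSemisimpleModule_of_le_radSocle hM.radical_le
  have hRJM : R.map f = JM := map_smul_top_of_surjective J f hfs
  let g : R →ₗ[Λ] JM := f.restrict fun x hx => hRJM.le ⟨x, hx, rfl⟩
  have hgs : Function.Surjective g := fun y => by
    obtain ⟨x, hx, hxy⟩ := hRJM.ge y.2
    exact ⟨⟨x, hx⟩, Subtype.ext hxy⟩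
  let g' : R ⧸ R' →ₗ[Λ] JM := R'.liftQ g (jacobson_smul_top_le_ker g)
  have hg's : Function.Surjective g' := fun y => by
    obtain ⟨x, rfl⟩ := hgs y
    exact ⟨R'.mkQ x, rfl⟩
  have hQ (j : Fin n) : homDim K Λ (LinearMap.ker g') (S j) = q j := by
    have h1 : homDim K Λ (R ⧸ R') (S j) = ∑ i, t i * D i j := by
      rw [homDim_quotient R' fun k => jacobson_smul_top_le_ker k,
        h.homDim_radical_projective j _ P rfl]
      simp_rw [htP]
    rw [homDim_eq_add_quotient (LinearMap.ker g'),
      homDim_congr_left (g'.quotKerEquivOfSurjective hg's), hM.radical, ← hq] at h1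
    omega
  let κ : N →ₗ[Λ] LinearMap.ker g' := (R'.mkQ ∘ₗ Submodule.inclusion hNR1).codRestrict _ fun x =>
    Subtype.ext x.2
  have hκs : Function.Surjective κ := by
    rintro ⟨y, hy⟩
    obtain ⟨x, rfl⟩ := R'.mkQ_surjective y
    exact ⟨⟨x, congrArg Subtype.val hy⟩, rfl⟩
  have hκ (x : N) : x ∈ LinearMap.ker κ ↔ (x : P) ∈ radSocle Λ P := by
    refine Iff.trans ?_ (hmemR' (Submodule.inclusion hNR1 x))
    rw [LinearMap.mem_ker, Subtype.ext_iff]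
    exact Submodule.Quotient.mk_eq_zero R'
  have hmemN (x : N) : x ∈ radSocle Λ N ↔ (x : P) ∈ radSocle Λ P :=
    forall₂_congr fun a _ => Subtype.ext_iff
  have hκN : LinearMap.ker κ = radSocle Λ N := by
    ext x
    rw [hκ, hmemN]
  refine ⟨fun hq0 => ?_, fun hq0 ht => ?_⟩
  -- A semisimple `N` would equal its socle `J² P`, forcing the quotient with multiplicities `q` to
  -- vanish.
  · have hnss : ¬ IsSemisimpleModule Λ N := fun hss => hq0 (funext fun j => by
      rw [radSocle_eq_top_of_isSemisimpleModule, LinearMap.ker_eq_top] at hκN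
      have : Subsingleton (LinearMap.ker g') := subsingleton_of_forall_eq 0 fun y => by
        obtain ⟨x, rfl⟩ := hκs y
        rw [hκN]; rfl
      have : Subsingleton (LinearMap.ker g' →ₗ[Λ] S j) :=
        ⟨fun f g => LinearMap.ext fun x => by rw [Subsingleton.elim x 0, map_zero, map_zero]⟩
      rw [← hQ]
      exact Module.finrank_zero_of_subsingleton)
    have hrad : J • (⊤ : Submodule Λ N) = radSocle Λ N := by
      refine le_antisymm (Submodule.smul_le.2 fun a ha x _ => ?_) (hEnd.radSocle_le hnss)
      rw [hmemN, hsoc]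
      exact Submodule.smul_mem_smul ha (hNR1 x.2)
    refine ⟨⟨inferInstance, hEnd, hrad.le, fun j => ?_, fun j => ?_⟩, fun hs => hnss inferInstance⟩
    · rw [← hQ, ← homDim_quotient (LinearMap.ker κ) fun k => by
        rw [hκN, ← hrad]; exact jacobson_smul_top_le_ker k]
      exact homDim_congr_left (κ.quotKerEquivOfSurjective hκs)
    · have := finite_submodule (K := K) (radSocle Λ N)
      rw [homDim_congr_left (LinearEquiv.ofEq _ _ hrad), homDim_comm,
        homDim_submodule _ fun k => range_le_radSocle k, hgN]
  · have := finite_submodule (K := K) (LinearMap.ker g')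
    have hsub := h.subsingleton_of_homDim_eq_zero (LinearMap.ker g') fun j => by rw [hQ, hq0]; rfl
    have hκ0 : radSocle Λ N = ⊤ := by
      rw [← hκN, eq_top_iff]
      exact fun x _ => Subsingleton.elim _ _
    have hss : IsSemisimpleModule Λ N := isSemisimpleModule_of_jacobson_smul_eq_zero
      fun a ha x => (hκ0.ge trivial : x ∈ radSocle Λ N) a ha
    have hnt : Nontrivial N := by
      by_contra hN0
      rw [not_nontrivial_iff_subsingleton] at hN0
      refine ht (funext fun j => ?_)
      rw [← hgN]
      have : Subsingleton (S j →ₗ[Λ] N) := ⟨fun f g => LinearMap.ext fun x => Subsingleton.elim _ _⟩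
      exact Module.finrank_zero_of_subsingleton
    have hsimple := hEnd.isSimpleModule
    obtain ⟨l, ⟨e⟩⟩ := h.exists_linearEquiv N
    refine ⟨l, funext fun j => ?_, ⟨e⟩⟩
    rw [← hgN, homDim_congr_right e, h.homDim_simple, Pi.single_apply]

/-- By induction the `j`-th syzygy has top `u (j + 1)` and radical `u j`; `u 0 = 0` because a simple
module has no radical. The vanishing of `u (m + 1)` makes the `m`-th syzygy simple. -/
theorem firstSimpleSyzygy [IsAlgClosed K] (h : IsOfDiagramType K D S)
    (hD : ∀ i, ∃ k, i ≠ k ∧ D i k ≠ 0) {m : ℕ} {σ : Fin n → Fin n}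
    (hu : ∀ i, ∃ u : ℕ → Fin n → ℕ, u 0 = 0 ∧ u 1 = Pi.single i 1 ∧
      (∀ k < m, ∀ j, u (k + 2) j + u k j = ∑ l, u (k + 1) l * D l j) ∧
      (∀ k < m, u (k + 1) ≠ 0) ∧ u (m + 1) = 0 ∧ u m = Pi.single (σ i) 1) :
    FirstSimpleSyzygy S m σ := by
  intro i
  obtain ⟨u, hu0, hu1, hrec, hne, hz, hσ⟩ := hu i
  have hm : 0 < m := by
    rcases Nat.eq_zero_or_pos m with rfl | hm
    · rw [hu0] at hσ
      simpa using congrFun hσ (σ i)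
    · exact hm
  have := h.isArtinianRing
  have key : ∀ j < m, ∀ N, IsNthSyzygy j (S i) N →
      HasLayers K S N (u (j + 1)) (u j) ∧ (0 < j → ¬ IsSimpleModule Λ N) := by
    intro j
    induction j with
    | zero =>
      rintro - N ⟨e⟩
      rw [hu0, hu1]
      exact ⟨(h.hasLayers_simple i).congr e.toLinearEquiv, fun h0 => absurd h0 (lt_irrefl 0)⟩
    | succ j ih =>
      rintro hj N ⟨L, hL, P, f, hf, ⟨e⟩⟩
      obtain ⟨h1, h2⟩ := (h.layers_ker hD (ih (by omega) L hL).1 hf (hrec j (by omega))).1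
        (hne _ hj)
      exact ⟨h1.congr e.symm, fun _ hN => h2 (IsSimpleModule.congr e.symm)⟩
  -- Existence of the syzygies is needed for the converse half of the final equivalence.
  have hex : ∀ j ≤ m, ∃ N, IsNthSyzygy j (S i) N := by
    intro j
    induction j with
    | zero => exact fun _ => ⟨S i, ⟨Iso.refl _⟩⟩
    | succ j ih =>
      intro hj
      obtain ⟨L, hL⟩ := ih (by omega)
      have := (key j hj L hL).1.finite
      obtain ⟨P, f, hf⟩ := exists_isProjectiveCover L
      exact ⟨ModuleCat.of Λ (LinearMap.ker f), L, hL, P, f, hf, ⟨LinearEquiv.refl _ _⟩⟩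
  refine ⟨fun j hj hjm N hN => (key j hjm N hN).2 hj, ?_⟩
  obtain ⟨m, rfl⟩ := Nat.exists_eq_add_one.2 hm
  have hlast : ∀ N, IsNthSyzygy (m + 1) (S i) N → Nonempty (N ≅ S (σ i)) := by
    rintro N ⟨L, hL, P, f, hf, ⟨e⟩⟩
    obtain ⟨l, hl, ⟨e'⟩⟩ := (h.layers_ker hD (key m (by omega) L hL).1 hf (hrec m (by omega))).2
      hz (hne m (by omega))
    obtain rfl : l = σ i := by
      by_contra hne
      have := congrFun (hl.symm.trans hσ) l
      simp [hne] at this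
    exact ⟨(e.trans e').toModuleIso⟩
  refine fun N => ⟨hlast N, fun ⟨e⟩ => ?_⟩
  obtain ⟨N', hN'⟩ := hex (m + 1) le_rfl
  obtain ⟨e'⟩ := hlast N' hN'
  obtain ⟨L, hL, P, f, hf, ⟨e''⟩⟩ := hN'
  exact ⟨L, hL, P, f, hf, ⟨(e.toLinearEquiv.trans e'.toLinearEquiv.symm).trans e''⟩⟩

end IsOfDiagramType

end HasLayers

/-! ### The sequences of multiplicities -/

/-- The properties of the multiplicities `u (k + 1)` of the simple modules in the top of `Ωᵏ (S i)`
that force `Ωᵐ (S i)` to be the first simple syzygy, with index `c`. -/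
structure IsSyzygySequence {n : ℕ} (D : Matrix (Fin n) (Fin n) ℕ) (m : ℕ) (i c : Fin n)
    (u : ℕ → Fin n → ℕ) : Prop where
  zero : u 0 = 0
  one : u 1 = Pi.single i 1
  recurrence : ∀ k < m, ∀ j, u (k + 2) j + u k j = ∑ l, u (k + 1) l * D l j
  ne_zero : ∀ k < m, u (k + 1) ≠ 0
  last_succ : u (m + 1) = 0
  last : u m = Pi.single c 1

theorem IsOfDiagramType.firstSimpleSyzygy_of_isSyzygySequence {K : Type v} [Field K]
    [IsAlgClosed K] {Λ : Type u} [Ring Λ] [Algebra K Λ] {n : ℕ} {D : Matrix (Fin n) (Fin n) ℕ}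
    {S : Fin n → ModuleCat.{u} Λ} (h : IsOfDiagramType K D S)
    (hD : ∀ i, ∃ k, i ≠ k ∧ D i k ≠ 0) {m : ℕ} {σ : Fin n → Fin n}
    (hu : ∀ i, ∃ u, IsSyzygySequence D m i (σ i) u) : FirstSimpleSyzygy S m σ :=
  h.firstSimpleSyzygy hD fun i =>
    let ⟨u, h0, h1, h2, h3, h4, h5⟩ := hu i
    ⟨u, h0, h1, h2, h3, h4, h5⟩

/-! #### Exceptional diagrams -/

/-- The digit of `r` of weight `10 ^ j`. -/
def decimalDigit (r j : ℕ) : ℕ := r / 10 ^ j % 10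

/-- The sequence of vectors whose coordinates are the decimal digits of the entries of a list. -/
def digitSequence {n : ℕ} (T : List ℕ) (k : ℕ) (j : Fin n) : ℕ := decimalDigit (T.getD k 0) j

/-- Packing each vector into one natural number leaves a finite check, made digit by digit; all
multiplicities in the tables are below ten. -/
theorem isSyzygySequence_digitSequence {n : ℕ} {D : Matrix (Fin n) (Fin n) ℕ} {A T : List ℕ}
    {m : ℕ} {i c : Fin n} (hA : ∀ l j : Fin n, D l j = decimalDigit (A.getD l 0) j)
    (hzero : T.getD 0 0 = 0) (hone : T.getD 1 0 = 10 ^ (i : ℕ))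
    (hrec : ∀ k < m, ∀ j : Fin n,
      decimalDigit (T.getD (k + 2) 0) j + decimalDigit (T.getD k 0) j =
        ((List.finRange n).map fun l : Fin n =>
          decimalDigit (T.getD (k + 1) 0) l * decimalDigit (A.getD l 0) j).sum)
    (hne : ∀ k < m, ∃ j : Fin n, decimalDigit (T.getD (k + 1) 0) j ≠ 0)
    (hz : T.getD (m + 1) 0 = 0) (hl : T.getD m 0 = 10 ^ (c : ℕ)) :
    IsSyzygySequence D m i c (digitSequence T) := by
  have hpow (a j : Fin n) : decimalDigit (10 ^ (a : ℕ)) j = (Pi.single a 1 : Fin n → ℕ) j := by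
    rw [Pi.single_apply, decimalDigit]
    rcases lt_trichotomy (j : ℕ) a with h | h | h
    · rw [if_neg (by omega), Nat.pow_div h.le (by norm_num)]
      exact Nat.mod_eq_zero_of_dvd (dvd_pow_self 10 (by omega))
    · rw [if_pos (Fin.ext h), h, Nat.div_self (by positivity)]
    · rw [if_neg (by omega), Nat.div_eq_of_lt (Nat.pow_lt_pow_right (by norm_num) h),
        Nat.zero_mod]
  refine ⟨?_, ?_, fun k hk j => ?_, fun k hk h => ?_, ?_, ?_⟩
  · ext j
    simp only [digitSequence, hzero]
    simp [decimalDigit]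
  · ext j
    simp only [digitSequence, hone, hpow]
  · rw [Fin.sum_univ_def]
    simp only [digitSequence, hA]
    exact hrec k hk j
  · obtain ⟨j, hj⟩ := hne k hk
    exact hj (congrFun h j)
  · ext j
    simp only [digitSequence, hz]
    simp [decimalDigit]
  · ext j
    simp only [digitSequence, hl, hpow]

/-- Multiplicities of the simple modules in the syzygies of the simple modules, in type `E6`: row
`i` lists the vectors for `S i`, whose coordinates are the decimal digits of the entries. -/
def syzygyTableE6 : List (List ℕ) :=
  [[0, 1, 10, 100, 11000, 100100, 10010, 101, 1010, 100, 10000, 100000, 0],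
   [0, 10, 101, 11010, 100200, 21010, 100201, 11020, 201, 11010, 100100, 10000, 0],
   [0, 100, 11010, 100201, 21020, 100301, 22020, 100301, 21020, 100201, 11010, 100, 0],
   [0, 1000, 100, 10010, 100101, 11010, 200, 11010, 100101, 10010, 100, 1000, 0],
   [0, 10000, 100100, 11010, 201, 11020, 100201, 21010, 100200, 11010, 101, 10, 0],
   [0, 100000, 10000, 100, 1010, 101, 10010, 100100, 11000, 100, 10, 1, 0]]

theorem isSyzygySequence_E6 (i : Fin 6) :
    IsSyzygySequence diagramE6 11 i (if i = 2 ∨ i = 3 then i else i.rev)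
      (digitSequence (syzygyTableE6.getD i [])) := by
  have hA : ∀ l j : Fin 6, diagramE6 l j =
      decimalDigit ([10, 101, 11010, 100, 100100, 10000].getD l 0) j := by
    unfold diagramE6 edgeMatrix
    decide
  apply isSyzygySequence_digitSequence hA <;> revert i <;> decide +kernel

/-- Multiplicities of the simple modules in the syzygies of the simple modules, in type `E7`: row
`i` lists the vectors for `S i`, whose coordinates are the decimal digits of the entries. -/
def syzygyTableE7 : List (List ℕ) :=
  [[0, 1, 10, 100, 1001000, 10100, 101010, 10101, 1001010, 200, 1001010, 10101, 101010, 10100,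
    1001000, 100, 10, 1, 0],
   [0, 10, 101, 1001010, 10200, 1102010, 20201, 1102020, 10301, 2002020, 10301, 1102020, 20201,
    1102010, 10200, 1001010, 101, 10, 0],
   [0, 100, 1001010, 10201, 1102020, 20301, 2103020, 20401, 2103030, 20402, 2103030, 20401,
    2103020, 20301, 1102020, 10201, 1001010, 100, 0],
   [0, 1000, 10100, 1101010, 10201, 1002020, 10301, 2102020, 20301, 1103020, 20301, 2102020,
    10301, 1002020, 10201, 1101010, 10100, 1000, 0],
   [0, 10000, 101000, 10100, 1001010, 201, 1001020, 10201, 1102010, 20200, 1102010, 10201,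
    1001020, 201, 1001010, 10100, 101000, 10000, 0],
   [0, 100000, 10000, 1000, 100, 1000010, 101, 1010, 10100, 1101000, 10100, 1010, 101, 1000010,
    100, 1000, 10000, 100000, 0],
   [0, 1000000, 100, 1010, 10101, 1101010, 10200, 1002010, 10201, 1101020, 10201, 1002010,
    10200, 1101010, 10101, 1010, 100, 1000000, 0]]

theorem isSyzygySequence_E7 (i : Fin 7) :
    IsSyzygySequence diagramE7 17 i i
      (digitSequence (syzygyTableE7.getD i [])) := by
  have hA : ∀ l j : Fin 7, diagramE7 l j =
      decimalDigit ([10, 101, 1001010, 10100, 101000, 10000, 100].getD l 0) j := by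
    unfold diagramE7 edgeMatrix
    decide
  apply isSyzygySequence_digitSequence hA <;> revert i <;> decide +kernel

/-- Multiplicities of the simple modules in the syzygies of the simple modules, in type `E8`: row
`i` lists the vectors for `S i`, whose coordinates are the decimal digits of the entries. -/
def syzygyTableE8 : List (List ℕ) :=
  [[0, 1, 10, 100, 10001000, 10100, 101010, 1010101, 10101010, 10200, 10002010, 10201, 10101020,
    1010201, 10102010, 20200, 10102010, 1010201, 10101020, 10201, 10002010, 10200, 10101010,
    1010101, 101010, 10100, 10001000, 100, 10, 1, 0],
   [0, 10, 101, 10001010, 10200, 10102010, 1020201, 10202020, 1020301, 20103020, 20401,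
    20103030, 1020402, 20203030, 1030401, 20204020, 1030401, 20203030, 1020402, 20103030, 20401,
    20103020, 1020301, 10202020, 1020201, 10102010, 10200, 10001010, 101, 10, 0],
   [0, 100, 10001010, 10201, 10102020, 1020301, 20203020, 1030401, 20204030, 1030502, 30204040,
    1030602, 30205040, 1040602, 30305040, 2040602, 30305040, 1040602, 30205040, 1030602,
    30204040, 1030502, 20204030, 1030401, 20203020, 1020301, 10102020, 10201, 10001010, 100, 0],
   [0, 1000, 10100, 10101010, 1010201, 10102020, 20301, 20103020, 1020401, 20203030, 1030402,
    20204030, 1030501, 30204030, 1030502, 20204040, 1030502, 30204030, 1030501, 20204030,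
    1030402, 20203030, 1020401, 20103020, 20301, 10102020, 1010201, 10101010, 10100, 1000, 0],
   [0, 10000, 101000, 1010100, 10101010, 10201, 10002020, 10301, 20102020, 1020301, 10203020,
    1030301, 20203020, 1020401, 20103030, 20402, 20103030, 1020401, 20203020, 1030301, 10203020,
    1020301, 20102020, 10301, 10002020, 10201, 10101010, 1010100, 101000, 10000, 0],
   [0, 100000, 1010000, 101000, 10100, 10001010, 201, 10001020, 10201, 10102010, 1020200,
    10202010, 1020201, 10102020, 10301, 20002020, 10301, 10102020, 1020201, 10202010, 1020200,
    10102010, 10201, 10001020, 201, 10001010, 10100, 101000, 1010000, 100000, 0],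
   [0, 1000000, 100000, 10000, 1000, 100, 10000010, 101, 1010, 10100, 10101000, 1010100, 101010,
    10101, 10001010, 200, 10001010, 10101, 101010, 1010100, 10101000, 10100, 1010, 101,
    10000010, 100, 1000, 10000, 100000, 1000000, 0],
   [0, 10000000, 100, 1010, 10101, 10101010, 1010200, 10102010, 20201, 10102020, 1010301,
    20102020, 20301, 10103020, 1020301, 20202020, 1020301, 10103020, 20301, 20102020, 1010301,
    10102020, 20201, 10102010, 1010200, 10101010, 10101, 1010, 100, 10000000, 0]]

theorem isSyzygySequence_E8 (i : Fin 8) :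
    IsSyzygySequence diagramE8 29 i i
      (digitSequence (syzygyTableE8.getD i [])) := by
  have hA : ∀ l j : Fin 8, diagramE8 l j =
      decimalDigit ([10, 101, 10001010, 10100, 101000, 1010000, 100000, 100].getD l 0) j := by
    unfold diagramE8 edgeMatrix
    decide
  apply isSyzygySequence_digitSequence hA <;> revert i <;> decide +kernel

/-! #### The line -/

/-- The solution, at time `k` and vertex `b`, of the discrete wave equation on the line
`1 — 2 — ⋯ — N` that vanishes at time `0` and is supported at the vertex `a` at time `1`. -/
def lineWave (N k a b : ℕ) : ℕ :=
  if a < b + k ∧ b < a + k ∧ k < a + b ∧ a + b + k ≤ 2 * N + 1 ∧ (a + b + k) % 2 = 1 then 1 else 0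

section LineWave

variable {N k a b : ℕ}

theorem lineWave_time_zero : lineWave N 0 a b = 0 := if_neg (by omega)

theorem lineWave_time_one (ha : 1 ≤ a) (haN : a ≤ N) :
    lineWave N 1 a b = if b = a then 1 else 0 := by
  unfold lineWave
  split_ifs <;> omega

theorem lineWave_left : lineWave N k a 0 = 0 := if_neg (by omega)

theorem lineWave_right : lineWave N k a (N + 1) = 0 := if_neg (by omega)

/-- The inequalities cut out the light cone of `a`, cancelled beyond its reflections in the walls
`0` and `N + 1`; at time `N` only the mirror image `N + 1 - a` remains. -/
theorem lineWave_recurrence (hk : k < N) (haN : a ≤ N) (hb : b < N) :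
    lineWave N (k + 2) a (b + 1) + lineWave N k a (b + 1) =
      lineWave N (k + 1) a b + lineWave N (k + 1) a (b + 2) := by
  unfold lineWave
  split_ifs <;> omega

theorem lineWave_time_last (ha : 1 ≤ a) (haN : a ≤ N) :
    lineWave N N a b = if a + b = N + 1 then 1 else 0 := by
  unfold lineWave
  split_ifs <;> omega

theorem lineWave_time_last_succ : lineWave N (N + 1) a b = 0 := if_neg (by omega)

theorem exists_lineWave_eq_one (hk : k < N) (ha : 1 ≤ a) (haN : a ≤ N) :
    ∃ b, 1 ≤ b ∧ b ≤ N ∧ lineWave N (k + 1) a b = 1 := by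
  rcases le_or_gt (k + 1) a with h | h
  · exact ⟨a - k, by omega, by omega, if_pos (by omega)⟩
  · exact ⟨k + 2 - a, by omega, by omega, if_pos (by omega)⟩

end LineWave

theorem sum_fin_ite_eq (n c : ℕ) (w : ℕ → ℕ) :
    ∑ l : Fin n, w l * (if (l : ℕ) = c then 1 else 0) = if c < n then w c else 0 := by
  rw [Fin.sum_univ_eq_sum_range (fun l => w l * if l = c then 1 else 0) n]
  simp

theorem sum_fin_ite_succ_eq (n c : ℕ) (w : ℕ → ℕ) :
    ∑ l : Fin n, w (l + 1) * (if (l : ℕ) + 1 = c then 1 else 0) =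
      if 1 ≤ c ∧ c ≤ n then w c else 0 := by
  rcases c with - | c
  · simp
  · simp only [Nat.add_right_cancel_iff]
    rw [sum_fin_ite_eq n c fun l => w (l + 1)]
    exact if_congr (by omega) rfl rfl

theorem sum_diagramA {n : ℕ} {w : ℕ → ℕ} (h0 : w 0 = 0) (hn : w (n + 1) = 0) (j : Fin n) :
    ∑ l : Fin n, w (l + 1) * diagramA n l j = w j + w (j + 2) := by
  have (l : Fin n) : w (l + 1) * diagramA n l j =
      w (l + 1) * (if (l : ℕ) + 1 = j then 1 else 0) +
      w (l + 1) * (if (l : ℕ) + 1 = j + 2 then 1 else 0) := by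
    rw [← mul_add]
    congr 1
    unfold diagramA edgeMatrix
    split_ifs <;> omega
  simp_rw [this, Finset.sum_add_distrib, sum_fin_ite_succ_eq]
  congr 1
  · split_ifs with h
    · rfl
    · rw [show (j : ℕ) = 0 by omega, h0]
  · split_ifs with h
    · rfl
    · rw [show (j : ℕ) + 2 = n + 1 by omega, hn]

/-- The loop amounts to a line with a phantom vertex `0` carrying the value at `1`. -/
theorem sum_diagramL {n : ℕ} {w : ℕ → ℕ} (h0 : w 0 = w 1) (hn : w (n + 1) = 0) (j : Fin n) :
    ∑ l : Fin n, w (l + 1) * diagramL n l j = w j + w (j + 2) := by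
  have (l : Fin n) : w (l + 1) * diagramL n l j =
      w (l + 1) * (if (l : ℕ) + 1 = (if (j : ℕ) = 0 then 1 else (j : ℕ)) then 1 else 0) +
      w (l + 1) * (if (l : ℕ) + 1 = j + 2 then 1 else 0) := by
    rw [← mul_add]
    congr 1
    unfold diagramL edgeMatrix
    split_ifs <;> omega
  simp_rw [this, Finset.sum_add_distrib, sum_fin_ite_succ_eq]
  congr 1
  · split_ifs with h h' h'
    · rw [h, h0]
    · omega
    · rfl
    · omega
  · split_ifs with h
    · rfl
    · rw [show (j : ℕ) + 2 = n + 1 by omega, hn]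

theorem sum_diagramD {n : ℕ} (h4 : 4 ≤ n) {w : ℕ → ℕ} (hn : w (n + 1) = 0) (j : Fin n) :
    ∑ l : Fin n, w (l + 1) * diagramD n l j =
      if (j : ℕ) ≤ 1 then w 3 else if (j : ℕ) = 2 then w 1 + w 2 + w 4 else w j + w (j + 2) := by
  have (l : Fin n) : w (l + 1) * diagramD n l j =
      -- Labels start at `1`, so in the next two summands the target `0` switches the summand off.
      w (l + 1) * (if (l : ℕ) + 1 = (if (j : ℕ) ≤ 1 then 3 else (j : ℕ)) then 1 else 0) +
      w (l + 1) * (if (l : ℕ) + 1 = (if (j : ℕ) ≤ 1 then 0 else (j : ℕ) + 2) then 1 else 0) +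
      w (l + 1) * (if (l : ℕ) + 1 = (if (j : ℕ) = 2 then 1 else 0) then 1 else 0) := by
    rw [← mul_add, ← mul_add]
    congr 1
    unfold diagramD edgeMatrix
    split_ifs <;> first | omega | contradiction
  simp_rw [this, Finset.sum_add_distrib, sum_fin_ite_succ_eq]
  have hj := j.2
  rcases lt_trichotomy (j : ℕ) 2 with h | h | h
  · simp [show (j : ℕ) ≤ 1 by omega, show (j : ℕ) ≠ 2 by omega, show 3 ≤ n by omega]
  · simp [h, h4, show 2 ≤ n by omega, show 1 ≤ n by omega]
    ring
  · simp only [show ¬ (j : ℕ) ≤ 1 by omega, show (j : ℕ) ≠ 2 by omega, if_false]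
    rcases eq_or_ne ((j : ℕ) + 1) n with h' | h'
    · simp [show (j : ℕ) + 2 = n + 1 by omega, hn, show 1 ≤ (j : ℕ) by omega, hj.le]
    · simp [show 1 ≤ (j : ℕ) by omega, hj.le, show (j : ℕ) + 2 ≤ n by omega]

/-! #### The diagrams `Aₙ` and `Lₙ` -/

theorem isSyzygySequence_A {n : ℕ} (i : Fin n) :
    IsSyzygySequence (diagramA n) n i i.rev fun k j => lineWave n k (i + 1) (j + 1) where
  zero := funext fun j => lineWave_time_zero
  one := funext fun j => by
    rw [lineWave_time_one (by omega) i.2, Pi.single_apply]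
    simp [Fin.ext_iff]
  recurrence k hk j := by
    rw [lineWave_recurrence hk i.2 j.2,
      sum_diagramA (w := fun b => lineWave n (k + 1) (i + 1) b) lineWave_left
        lineWave_right j]
  ne_zero k hk h := by
    obtain ⟨b, hb, hbn, hw⟩ := exists_lineWave_eq_one hk (Nat.succ_pos i) i.2
    have := congrFun h ⟨b - 1, by omega⟩
    simp [Nat.sub_add_cancel hb, hw] at this
  last_succ := funext fun j => lineWave_time_last_succ
  last := funext fun j => by
    rw [lineWave_time_last (by omega) i.2, Pi.single_apply]
    refine if_congr ?_ rfl rfl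
    rw [Fin.ext_iff, Fin.val_rev]
    omega

/-- `Lₙ` is the line with `2 n` vertices folded by `b ↦ 2 n + 1 - b`: label `b` lies under `n + b`
and `n + 1 - b`, and the middle edge becomes the loop. Values over a label are added. -/
theorem isSyzygySequence_L {n : ℕ} (i : Fin n) :
    IsSyzygySequence (diagramL n) (2 * n) i i fun k j =>
      lineWave (2 * n) k (n + (i + 1)) (n + (j + 1)) +
      lineWave (2 * n) k (n + (i + 1)) (n + 1 - (j + 1)) where
  zero := funext fun j => by simp [lineWave_time_zero]
  one := funext fun j => by
    rw [lineWave_time_one (by omega) (by omega), lineWave_time_one (by omega) (by omega),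
      Pi.single_apply, if_neg (show ¬ n + 1 - ((j : ℕ) + 1) = n + (i + 1) by omega), add_zero]
    exact if_congr (by rw [Fin.ext_iff]; omega) rfl rfl
  recurrence k hk j := by
    rw [sum_diagramL (w := fun b => lineWave (2 * n) (k + 1) (n + (i + 1)) (n + b) +
      lineWave (2 * n) (k + 1) (n + (i + 1)) (n + 1 - b))
      (by simp [add_comm]) (by
        rw [show n + (n + 1) = 2 * n + 1 by omega, lineWave_right, Nat.sub_self,
          lineWave_left]) j]
    have h1 := lineWave_recurrence (N := 2 * n) (a := n + (i + 1)) (b := n + j) hk (by omega)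
      (by omega)
    have h2 := lineWave_recurrence (N := 2 * n) (a := n + (i + 1)) (b := n + 1 - (j + 2)) hk
      (by omega) (by omega)
    rw [show n + 1 - ((j : ℕ) + 2) + 1 = n + 1 - (j + 1) by omega,
      show n + 1 - ((j : ℕ) + 2) + 2 = n + 1 - j by omega] at h2
    rw [add_assoc] at h1
    rw [add_assoc n j 2] at h1
    omega
  ne_zero k hk h := by
    obtain ⟨b, hb, hbn, hw⟩ := exists_lineWave_eq_one (a := n + (i + 1)) hk (by omega) (by omega)
    rcases le_or_gt b n with hbn' | hbn'
    · have := congrFun h ⟨n - b, by omega⟩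
      simp [show n + 1 - (n - b + 1) = b by omega, hw] at this
    · have := congrFun h ⟨b - n - 1, by omega⟩
      simp [show n + (b - n - 1 + 1) = b by omega, hw] at this
  last_succ := funext fun j => by simp [lineWave_time_last_succ]
  last := funext fun j => by
    rw [lineWave_time_last (by omega) (by omega), lineWave_time_last (by omega) (by omega),
      Pi.single_apply, if_neg (by omega), zero_add]
    exact if_congr (by rw [Fin.ext_iff]; omega) rfl rfl

/-! #### The diagrams `Dₙ` -/

/-- The line with `2 n - 3` vertices is folded about its centre `n - 1`: each short leg carries the
central value, and every other vertex the sum over a mirror pair. -/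
theorem isSyzygySequence_D_of_two_le {n : ℕ} (h4 : 4 ≤ n) {i : Fin n} (hi : 2 ≤ (i : ℕ)) :
    IsSyzygySequence (diagramD n) (2 * n - 3) i i fun k j =>
      if (j : ℕ) ≤ 1 then lineWave (2 * n - 3) k (n + i - 2) (n - 1) else
        lineWave (2 * n - 3) k (n + i - 2) (n + j - 2) +
        lineWave (2 * n - 3) k (n + i - 2) (n - j) where
  zero := funext fun j => by simp [lineWave_time_zero]
  one := funext fun j => by
    rw [Pi.single_apply]
    simp only [lineWave_time_one (N := 2 * n - 3) (a := n + i - 2) (by omega) (by omega),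
      Fin.ext_iff]
    split_ifs <;> omega
  recurrence k hk j := by
    have hr (b : ℕ) (hb : b < 2 * n - 3) := lineWave_recurrence (N := 2 * n - 3) (a := n + i - 2)
      hk (by omega) hb
    have hD := sum_diagramD h4 (w := fun b =>
      if b ≤ 2 then lineWave (2 * n - 3) (k + 1) (n + i - 2) (n - 1) else
        lineWave (2 * n - 3) (k + 1) (n + i - 2) (n + b - 3) +
        lineWave (2 * n - 3) (k + 1) (n + i - 2) (n + 1 - b)) (by
          rw [if_neg (by omega), show n + (n + 1) - 3 = 2 * n - 3 + 1 by omega, lineWave_right,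
            Nat.sub_self, lineWave_left]) j
    refine Eq.trans ?_ (hD.symm.trans <| Finset.sum_congr rfl fun l _ => ?_)
    swap
    · rw [show n + ((l : ℕ) + 1) - 3 = n + l - 2 by omega, Nat.add_sub_add_right]
      exact congrArg (· * _) (if_congr (by omega) rfl rfl)
    rcases lt_trichotomy (j : ℕ) 2 with h | h | h
    · have h1 := hr (n - 2) (by omega)
      rw [show n - 2 + 1 = n - 1 by omega, show n - 2 + 2 = n by omega] at h1
      simp only [show (j : ℕ) ≤ 1 by omega, if_true]
      rw [h1, add_comm]
      simp [show n + 1 - 3 = n - 2 by omega]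
    · have h1 := hr (n - 1) (by omega)
      have h2 := hr (n - 3) (by omega)
      rw [show n - 1 + 1 = n by omega, show n - 1 + 2 = n + 1 by omega] at h1
      rw [show n - 3 + 1 = n - 2 by omega, show n - 3 + 2 = n - 1 by omega] at h2
      simp [h, show n + 4 - 3 = n + 1 by omega, show n + 1 - 4 = n - 3 by omega]
      omega
    · have h1 := hr (n + j - 3) (by omega)
      have h2 := hr (n - j - 1) (by omega)
      rw [show n + (j : ℕ) - 3 + 1 = n + j - 2 by omega,
        show n + (j : ℕ) - 3 + 2 = n + j - 1 by omega] at h1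
      rw [show n - (j : ℕ) - 1 + 1 = n - j by omega,
        show n - (j : ℕ) - 1 + 2 = n + 1 - j by omega] at h2
      simp only [show ¬ (j : ℕ) ≤ 1 by omega, show ¬ (j : ℕ) = 2 by omega,
        show ¬ (j : ℕ) ≤ 2 by omega, show ¬ (j : ℕ) + 2 ≤ 2 by omega, if_false,
        show n + ((j : ℕ) + 2) - 3 = n + j - 1 by omega,
        show n + 1 - ((j : ℕ) + 2) = n - j - 1 by omega]
      omega
  ne_zero k hk h := by
    obtain ⟨b, hb, hbn, hw⟩ := exists_lineWave_eq_one (a := n + i - 2) hk (by omega) (by omega)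
    rcases lt_trichotomy b (n - 1) with h' | h' | h'
    · have := congrFun h ⟨n - b, by omega⟩
      simp [show ¬ n - b ≤ 1 by omega, show n - (n - b) = b by omega, hw] at this
    · have := congrFun h ⟨0, by omega⟩
      simp [← h', hw] at this
    · have := congrFun h ⟨b + 2 - n, by omega⟩
      simp [show ¬ b + 2 - n ≤ 1 by omega, show n + (b + 2 - n) - 2 = b by omega, hw] at this
  last_succ := funext fun j => by simp [lineWave_time_last_succ]
  last := funext fun j => by
    rw [Pi.single_apply]
    simp only [lineWave_time_last (N := 2 * n - 3) (a := n + i - 2) (by omega) (by omega),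
      Fin.ext_iff]
    split_ifs <;> omega

/-- The wave issued from the centre of the line with `2 n - 3` vertices is symmetric, so one half
describes the long arm. Its central pulses, at odd times, fall alternately on the two short legs,
starting with `i`; the residue of `2 n - 3` modulo `4` decides which leg is hit last. -/
theorem isSyzygySequence_D_of_lt_two {n : ℕ} (h4 : 4 ≤ n) {i c : Fin n} (hi : (i : ℕ) < 2)
    (hc : (c : ℕ) = if Odd n then 1 - (i : ℕ) else i) :
    IsSyzygySequence (diagramD n) (2 * n - 3) i c fun k j =>
      if (j : ℕ) = i then if k % 4 = 1 ∧ k ≤ 2 * n - 3 then 1 else 0 else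
      if (j : ℕ) ≤ 1 then if k % 4 = 3 ∧ k ≤ 2 * n - 3 then 1 else 0 else
        lineWave (2 * n - 3) k (n - 1) (n + j - 2) where
  zero := funext fun j => by simp [lineWave_time_zero]
  one := funext fun j => by
    rw [Pi.single_apply]
    simp only [lineWave_time_one (N := 2 * n - 3) (a := n - 1) (by omega) (by omega),
      Fin.ext_iff, true_and]
    clear hc
    split_ifs <;> omega
  recurrence k hk j := by
    have hr (b : ℕ) (hb : b < 2 * n - 3) := lineWave_recurrence (N := 2 * n - 3) (a := n - 1)
      hk (by omega) hb
    have hD := sum_diagramD h4 (w := fun b =>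
      if b = i + 1 then if (k + 1) % 4 = 1 ∧ k + 1 ≤ 2 * n - 3 then 1 else 0 else
      if b ≤ 2 then if (k + 1) % 4 = 3 ∧ k + 1 ≤ 2 * n - 3 then 1 else 0 else
        lineWave (2 * n - 3) (k + 1) (n - 1) (n + b - 3)) (by
          rw [if_neg (by omega), if_neg (by omega), show n + (n + 1) - 3 = 2 * n - 3 + 1 by omega,
            lineWave_right]) j
    refine Eq.trans ?_ (hD.symm.trans <| Finset.sum_congr rfl fun l _ => ?_)
    swap
    · rw [show n + ((l : ℕ) + 1) - 3 = n + l - 2 by omega]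
      exact congrArg (· * _) (if_congr (by omega) rfl (if_congr (by omega) rfl rfl))
    have hi' : (i : ℕ) = 0 ∨ (i : ℕ) = 1 := by omega
    rcases lt_trichotomy (j : ℕ) 2 with h | h | h
    · have hw3 : lineWave (2 * n - 3) (k + 1) (n - 1) n = if k % 2 = 1 then 1 else 0 := by
        unfold lineWave
        split_ifs <;> omega
      simp only [show (j : ℕ) ≤ 1 by omega, if_true, show ¬ 3 = (i : ℕ) + 1 by omega, if_false,
        show ¬ 3 ≤ 2 by omega, show n + 3 - 3 = n by omega, hw3]
      split_ifs <;> omega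
    · have h1 := hr (n - 1) (by omega)
      rw [show n - 1 + 1 = n by omega, show n - 1 + 2 = n + 1 by omega] at h1
      have hw1 : lineWave (2 * n - 3) (k + 1) (n - 1) (n - 1) = if k % 2 = 0 then 1 else 0 := by
        unfold lineWave
        split_ifs <;> omega
      rw [hw1] at h1
      simp only [h, show ¬ 2 = (i : ℕ) by omega, show ¬ 2 ≤ 1 by omega, if_false, if_true,
        show ¬ 4 = (i : ℕ) + 1 by omega, show ¬ 4 ≤ 2 by omega, show n + 2 - 2 = n by omega,
        show n + 4 - 3 = n + 1 by omega, show 1 ≤ 2 by omega, le_refl, h1]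
      rcases hi' with h' | h' <;> simp only [h'] <;> split_ifs <;> omega
    · have h1 := hr (n + j - 3) (by omega)
      rw [show n + (j : ℕ) - 3 + 1 = n + j - 2 by omega,
        show n + (j : ℕ) - 3 + 2 = n + j - 1 by omega] at h1
      simp only [show ¬ (j : ℕ) ≤ 1 by omega, show ¬ (j : ℕ) = 2 by omega,
        show ¬ (j : ℕ) ≤ 2 by omega, show ¬ (j : ℕ) + 2 ≤ 2 by omega, if_false,
        show ¬ (j : ℕ) = i by omega, show ¬ (j : ℕ) = i + 1 by omega,
        show ¬ (j : ℕ) + 2 = i + 1 by omega,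
        show n + ((j : ℕ) + 2) - 3 = n + j - 1 by omega]
      exact h1
  ne_zero k hk h := by
    rcases Nat.even_or_odd k with hk' | hk'
    · rw [Nat.even_iff] at hk'
      have h0 := congrFun h ⟨0, by omega⟩
      have h1 := congrFun h ⟨1, by omega⟩
      simp only [Pi.zero_apply] at h0 h1
      split_ifs at h0 h1 <;> omega
    · rw [Nat.odd_iff] at hk'
      have := congrFun h ⟨2, by omega⟩
      simp only [Pi.zero_apply, lineWave] at this
      split_ifs at this <;> omega
  last_succ := funext fun j => by
    simp [lineWave_time_last_succ]
  last := funext fun j => by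
    rw [Pi.single_apply]
    simp only [lineWave_time_last (N := 2 * n - 3) (a := n - 1) (by omega) (by omega),
      Fin.ext_iff, hc, Nat.odd_iff]
    split_ifs <;> omega

theorem isSyzygySequence_D {n : ℕ} (h4 : 4 ≤ n) (h0 : 0 < n) (h1 : 1 < n) (i : Fin n) :
    ∃ u, IsSyzygySequence (diagramD n) (2 * n - 3) i
      ((if Odd n then Equiv.swap (⟨0, h0⟩ : Fin n) ⟨1, h1⟩ else id : Fin n → Fin n) i) u := by
  rcases lt_or_ge (i : ℕ) 2 with hi | hi
  · refine ⟨_, isSyzygySequence_D_of_lt_two h4 hi ?_⟩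
    split_ifs
    · rcases (by omega : (i : ℕ) = 0 ∨ (i : ℕ) = 1) with h | h
      · rw [show i = ⟨0, h0⟩ from Fin.ext h, Equiv.swap_apply_left]
        rfl
      · rw [show i = ⟨1, h1⟩ from Fin.ext h, Equiv.swap_apply_right]
        rfl
    · rfl
  · have : (if Odd n then Equiv.swap (⟨0, h0⟩ : Fin n) ⟨1, h1⟩ else id :
        Fin n → Fin n) i = i := by
      split_ifs
      · exact Equiv.swap_apply_of_ne_of_ne (by rw [Ne, Fin.ext_iff]; dsimp; omega)
          (by rw [Ne, Fin.ext_iff]; dsimp; omega)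
      · rfl
    rw [this]
    exact ⟨_, isSyzygySequence_D_of_two_le h4 hi⟩

/-! #### Every vertex has a neighbour -/

theorem exists_diagramA_ne_zero {n : ℕ} (hn : 2 ≤ n) (i : Fin n) :
    ∃ k, i ≠ k ∧ diagramA n i k ≠ 0 := by
  rcases Nat.eq_zero_or_pos (i : ℕ) with h | h
  · refine ⟨⟨1, by omega⟩, by rw [Ne, Fin.ext_iff]; dsimp; omega, ?_⟩
    simp [diagramA, edgeMatrix, h]
  · refine ⟨⟨i - 1, by omega⟩, by rw [Ne, Fin.ext_iff]; dsimp; omega, ?_⟩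
    simp [diagramA, edgeMatrix]
    omega

theorem exists_diagramL_ne_zero {n : ℕ} (hn : 2 ≤ n) (i : Fin n) :
    ∃ k, i ≠ k ∧ diagramL n i k ≠ 0 := by
  rcases Nat.eq_zero_or_pos (i : ℕ) with h | h
  · refine ⟨⟨1, by omega⟩, by rw [Ne, Fin.ext_iff]; dsimp; omega, ?_⟩
    simp [diagramL, edgeMatrix, h]
  · refine ⟨⟨i - 1, by omega⟩, by rw [Ne, Fin.ext_iff]; dsimp; omega, ?_⟩
    simp [diagramL, edgeMatrix]
    omega

theorem exists_diagramD_ne_zero {n : ℕ} (h4 : 4 ≤ n) (i : Fin n) :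
    ∃ k, i ≠ k ∧ diagramD n i k ≠ 0 := by
  rcases lt_or_ge (i : ℕ) 2 with h | h
  · refine ⟨⟨2, by omega⟩, by rw [Ne, Fin.ext_iff]; dsimp; omega, ?_⟩
    simp [diagramD, edgeMatrix]
    omega
  · rcases eq_or_lt_of_le h with h | h
    · refine ⟨⟨0, by omega⟩, by rw [Ne, Fin.ext_iff]; dsimp; omega, ?_⟩
      simp [diagramD, edgeMatrix, ← h]
    · refine ⟨⟨i - 1, by omega⟩, by rw [Ne, Fin.ext_iff]; dsimp; omega, ?_⟩
      simp [diagramD, edgeMatrix]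
      omega

theorem exists_diagramE6_ne_zero : ∀ i, ∃ k, i ≠ k ∧ diagramE6 i k ≠ 0 := by
  unfold diagramE6 edgeMatrix
  decide

theorem exists_diagramE7_ne_zero : ∀ i, ∃ k, i ≠ k ∧ diagramE7 i k ≠ 0 := by
  unfold diagramE7 edgeMatrix
  decide

theorem exists_diagramE8_ne_zero : ∀ i, ∃ k, i ≠ k ∧ diagramE8 i k ≠ 0 := by
  unfold diagramE8 edgeMatrix
  decide

theorem mainTheorem5 (K : Type v) [Field K] [IsAlgClosed K] (Λ : Type u) [Ring Λ] [Algebra K Λ] :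
    (∀ (n : ℕ) (_ : 2 ≤ n) (S : Fin n → ModuleCat.{u} Λ),
      IsOfDiagramType K (diagramA n) S → FirstSimpleSyzygy S n Fin.rev) ∧
    (∀ (n : ℕ) (_ : 2 ≤ n) (S : Fin n → ModuleCat.{u} Λ),
      IsOfDiagramType K (diagramL n) S → FirstSimpleSyzygy S (2 * n) id) ∧
    (∀ (n : ℕ) (hn : 4 ≤ n) (S : Fin n → ModuleCat.{u} Λ),
      IsOfDiagramType K (diagramD n) S →
        FirstSimpleSyzygy S (2 * n - 3)
          (if Odd n then Equiv.swap (⟨0, by omega⟩ : Fin n) ⟨1, by omega⟩ else id)) ∧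
    (∀ S : Fin 6 → ModuleCat.{u} Λ,
      IsOfDiagramType K diagramE6 S →
        FirstSimpleSyzygy S 11 (fun i => if i = 2 ∨ i = 3 then i else i.rev)) ∧
    (∀ S : Fin 7 → ModuleCat.{u} Λ,
      IsOfDiagramType K diagramE7 S → FirstSimpleSyzygy S 17 id) ∧
    (∀ S : Fin 8 → ModuleCat.{u} Λ,
      IsOfDiagramType K diagramE8 S → FirstSimpleSyzygy S 29 id) :=
  ⟨fun _ hn _ h => h.firstSimpleSyzygy_of_isSyzygySequence (exists_diagramA_ne_zero hn)
      fun i => ⟨_, isSyzygySequence_A i⟩,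
    fun _ hn _ h => h.firstSimpleSyzygy_of_isSyzygySequence (exists_diagramL_ne_zero hn)
      fun i => ⟨_, isSyzygySequence_L i⟩,
    fun _ hn _ h => h.firstSimpleSyzygy_of_isSyzygySequence (exists_diagramD_ne_zero hn)
      (isSyzygySequence_D hn _ _),
    fun _ h => h.firstSimpleSyzygy_of_isSyzygySequence exists_diagramE6_ne_zero
      fun i => ⟨_, isSyzygySequence_E6 i⟩,
    fun _ h => h.firstSimpleSyzygy_of_isSyzygySequence exists_diagramE7_ne_zero
      fun i => ⟨_, isSyzygySequence_E7 i⟩,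
    fun _ h => h.firstSimpleSyzygy_of_isSyzygySequence exists_diagramE8_ne_zero
      fun i => ⟨_, isSyzygySequence_E8 i⟩⟩
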